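/- All von Neumann algebras act on complex Hilbert spaces. An \emph{NCP-map} between von Neumann algebras is a completely positive linear map that is normal, i.e. preserves suprema of bounded directed sets of self-adjoint elements. Let $\mathscr{A},\mathscr{B}$ be von Neumann algebras and let $[0,1]_{\mathscr{A}}=\{a\in\mathscr{A}: 0\le a\le 1\}$. A contractive NCP-map $h\colon\mathscr{A}\to\mathscr{B}$ is a \emph{corner} if for some $a\in[0,1]_{\mathscr{A}}$ we have $h(a)=h(1)$ and, for every von Neumann algebra $\mathscr{C}$ and every contractive NCP-map $f\colon\mathscr{A}\to\mathscr{C}$ with $f(a)=f(1)$, there is a unique contractive NCP-map $f'\colon\mathscr{B}\to\mathscr{C}$ with $f=f'\circ h$. A contractive NCP-map $c\colon\mathscr{B}\to\mathscr{A}$ is a \emph{compression} if for some $a\in[0,1]_{\mathscr{A}}$ we have $c(1)=a$ and, for every von Neumann algebra $\mathscr{C}$ and every contractive NCP-map $g\colon\mathscr{C}\to\mathscr{A}$ with $g(1)\le a$, there is a unique contractive NCP-map $g'\colon\mathscr{C}\to\mathscr{B}$ with $g=c\circ g'$. For a contractive NCP-map $\varphi\colon\mathscr{A}\to\mathscr{B}$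 let $p$ be its carrier, the least projection of $\mathscr{A}$ with $\varphi(p)=\varphi(1)$, and let $q=\lceil\varphi(1)\rceil$ be the least projection of $\mathscr{B}$ above $\varphi(1)$. Let $\varphi_\measuredangle\colon p\mathscr{A}p\to q\mathscr{B}q$ be the unique NCP-map with $\varphi(x)=\sqrt{\varphi(1)}\,\varphi_\measuredangle(pxp)\,\sqrt{\varphi(1)}$ for all $x\in\mathscr{A}$. For a non-contractive NCP-map $\varphi$ put $\varphi_\measuredangle=(\tfrac{1}{\|\varphi\|}\varphi)_\measuredangle$. An NCP-map $\varphi$ is \emph{pure} if $\varphi_\measuredangle$ is an isomorphism (has an inverse that is an NCP-map). \textbf{Proposition.} Let $\varphi\colon\mathscr{A}\to\mathscr{B}$ and $\psi\colon\mathscr{B}\to\mathscr{C}$ be maps between von Neumann algebras. If $\varphi$ and $\psi$ are both corners, then $\psi\circ\varphi$ is a corner. If both are compressions, then $\psi\circ\varphi$ is a compression. If both are pure NCP-maps, then $\psi\circ\varphi$ is a pure NCP-map. -/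

import Mathlib

open scoped CStarAlgebra

universe u

noncomputable section

set_option linter.unusedSectionVars false

namespace VonNeumannAlgebra

variable {H K : Type u} [NormedAddCommGroup H] [InnerProductSpace ℂ H] [CompleteSpace H]
  [NormedAddCommGroup K] [InnerProductSpace ℂ K] [CompleteSpace K]

/-! ### A von Neumann algebra as an ordered C⋆-algebra -/

instance instSMulMemClass : SMulMemClass (VonNeumannAlgebra H) ℂ (H →L[ℂ] H) where
  smul_mem {S} r _ hx := S.toStarSubalgebra.smul_mem hx r

instance instIsClosed (A : VonNeumannAlgebra H) : IsClosed (A : Set (H →L[ℂ] H)) := by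
  rw [← A.centralizer_centralizer]
  exact Set.isClosed_centralizer _

/-- The elements of a von Neumann algebra `A`, with the algebraic operations, the norm and the
order inherited from the bounded operators. -/
def Elem (A : VonNeumannAlgebra H) : Type u := {x : H →L[ℂ] H // x ∈ A}

instance instCStarAlgebra (A : VonNeumannAlgebra H) : CStarAlgebra A.Elem :=
  inferInstanceAs (CStarAlgebra A)

instance instPartialOrderElem (A : VonNeumannAlgebra H) : PartialOrder A.Elem :=
  PartialOrder.lift Subtype.val Subtype.val_injective

/-- The bounded operator underlying an element of `A`. -/
@[coe]
def Elem.op {A : VonNeumannAlgebra H} (x : A.Elem) : H →L[ℂ] H := Subtype.val x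

instance instCoeOut (A : VonNeumannAlgebra H) : CoeOut A.Elem (H →L[ℂ] H) := ⟨Elem.op⟩

/-- An operator belonging to `A`, as an element of `A`. -/
def Elem.mk {A : VonNeumannAlgebra H} (x : H →L[ℂ] H) (hx : x ∈ A) : A.Elem := ⟨x, hx⟩

namespace Elem

variable {A : VonNeumannAlgebra H}

theorem op_mem (x : A.Elem) : (x : H →L[ℂ] H) ∈ A := Subtype.property x

theorem ext_op {x y : A.Elem} (h : (x : H →L[ℂ] H) = y) : x = y := Subtype.ext h

theorem op_mk (x : H →L[ℂ] H) (hx : x ∈ A) : (Elem.mk x hx : H →L[ℂ] H) = x := rfl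

theorem op_add (x y : A.Elem) : ((x + y : A.Elem) : H →L[ℂ] H) = x + y := rfl

theorem op_sub (x y : A.Elem) : ((x - y : A.Elem) : H →L[ℂ] H) = x - y := rfl

theorem op_mul (x y : A.Elem) : ((x * y : A.Elem) : H →L[ℂ] H) = x * y := rfl

theorem op_smul (r : ℂ) (x : A.Elem) : ((r • x : A.Elem) : H →L[ℂ] H) = r • (x : H →L[ℂ] H) := rfl

theorem op_star (x : A.Elem) : ((star x : A.Elem) : H →L[ℂ] H) = star (x : H →L[ℂ] H) := rfl

theorem op_zero : ((0 : A.Elem) : H →L[ℂ] H) = 0 := rfl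

theorem op_one : ((1 : A.Elem) : H →L[ℂ] H) = 1 := rfl

theorem norm_op (x : A.Elem) : ‖(x : H →L[ℂ] H)‖ = ‖x‖ := rfl

theorem op_le_op {x y : A.Elem} : (x : H →L[ℂ] H) ≤ y ↔ x ≤ y := Iff.rfl

end Elem

theorem sqrt_mem (A : VonNeumannAlgebra H) {x : H →L[ℂ] H} (hx : x ∈ A) :
    CFC.sqrt x ∈ A := by
  rw [← SetLike.mem_coe, ← A.centralizer_centralizer, Set.mem_centralizer_iff]
  intro y hy
  have h : Commute x y := by
    rw [Set.mem_centralizer_iff] at hy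
    exact hy x hx
  exact (h.cfcₙ_nnreal _).symm.eq

instance instStarOrderedRing (A : VonNeumannAlgebra H) : StarOrderedRing A.Elem := by
  refine StarOrderedRing.of_le_iff fun x y => ⟨fun h => ?_, ?_⟩
  · have h0 : (0 : H →L[ℂ] H) ≤ (y : H →L[ℂ] H) - x := sub_nonneg.mpr h
    refine ⟨Elem.mk (CFC.sqrt ((y : H →L[ℂ] H) - x))
      (A.sqrt_mem (sub_mem y.op_mem x.op_mem)), Elem.ext_op ?_⟩
    have hs : star (CFC.sqrt ((y : H →L[ℂ] H) - x)) = CFC.sqrt ((y : H →L[ℂ] H) - x) :=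
      (IsSelfAdjoint.of_nonneg (CFC.sqrt_nonneg _)).star_eq
    rw [Elem.op_add, Elem.op_mul, Elem.op_star, Elem.op_mk, hs, CFC.sqrt_mul_sqrt_self _ h0]
    abel
  · rintro ⟨s, rfl⟩
    rw [← Elem.op_le_op, Elem.op_add, Elem.op_mul, Elem.op_star]
    exact le_add_of_nonneg_right (star_mul_self_nonneg _)

/-! ### Normal completely positive maps -/

/-- An *NCP-map*: a completely positive map that is normal, i.e. preserves the suprema of
bounded directed sets of self-adjoint elements. (Completely positive maps are automatically
bounded, so nothing is lost by working with continuous linear maps.) -/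
structure IsNCP {A : VonNeumannAlgebra H} {B : VonNeumannAlgebra K} (φ : A.Elem →L[ℂ] B.Elem) : Prop where
  completelyPositive : ∃ ψ : A.Elem →CP B.Elem, ∀ x, ψ x = φ x
  normal : ScottContinuousOn {D : Set A.Elem | ∀ d ∈ D, IsSelfAdjoint d} φ

/-- A contractive NCP-map. -/
structure IsContractiveNCP {A : VonNeumannAlgebra H} {B : VonNeumannAlgebra K}
    (φ : A.Elem →L[ℂ] B.Elem) : Prop extends IsNCP φ where
  norm_le_one : ‖φ‖ ≤ 1

/-- An isomorphism in the category of von Neumann algebras and NCP-maps. -/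
def IsNCPIso {A : VonNeumannAlgebra H} {B : VonNeumannAlgebra K} (φ : A.Elem →L[ℂ] B.Elem) : Prop :=
  IsNCP φ ∧ ∃ ψ : B.Elem →L[ℂ] A.Elem, IsNCP ψ ∧ (∀ x, ψ (φ x) = x) ∧ ∀ y, φ (ψ y) = y

/-! ### Corners and compressions -/

/-- `h : A → B` is a corner for the effect `a` of `A`. -/
structure IsCornerFor {A : VonNeumannAlgebra H} {B : VonNeumannAlgebra K}
    (h : A.Elem →L[ℂ] B.Elem) (a : A.Elem) : Prop where
  isContractiveNCP : IsContractiveNCP h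
  nonneg : 0 ≤ a
  le_one : a ≤ 1
  map_eq : h a = h 1
  universal : ∀ {L : Type u} [NormedAddCommGroup L] [InnerProductSpace ℂ L] [CompleteSpace L]
    (C : VonNeumannAlgebra L) (f : A.Elem →L[ℂ] C.Elem), IsContractiveNCP f → f a = f 1 →
    ∃! f' : B.Elem →L[ℂ] C.Elem, IsContractiveNCP f' ∧ f'.comp h = f

/-- `c : B → A` is a compression for the effect `a` of `A`. -/
structure IsCompressionFor {A : VonNeumannAlgebra H} {B : VonNeumannAlgebra K}
    (c : B.Elem →L[ℂ] A.Elem) (a : A.Elem) : Prop where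
  isContractiveNCP : IsContractiveNCP c
  nonneg : 0 ≤ a
  le_one : a ≤ 1
  map_one : c 1 = a
  universal : ∀ {L : Type u} [NormedAddCommGroup L] [InnerProductSpace ℂ L] [CompleteSpace L]
    (C : VonNeumannAlgebra L) (g : C.Elem →L[ℂ] A.Elem), IsContractiveNCP g → g 1 ≤ a →
    ∃! g' : C.Elem →L[ℂ] B.Elem, IsContractiveNCP g' ∧ c.comp g' = g

/-- `h` is a corner (for some effect). -/
def IsCorner {A : VonNeumannAlgebra H} {B : VonNeumannAlgebra K} (h : A.Elem →L[ℂ] B.Elem) : Prop :=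
  ∃ a : A.Elem, IsCornerFor h a

/-- `c` is a compression (for some effect). -/
def IsCompression {A : VonNeumannAlgebra H} {B : VonNeumannAlgebra K} (c : B.Elem →L[ℂ] A.Elem) : Prop :=
  ∃ a : A.Elem, IsCompressionFor c a

/-! ### The von Neumann algebra `pAp` -/

/-- The Hilbert space `pH = {v | p v = v}` of a projection `p` on `H`. -/
def FixedSpace (p : H →L[ℂ] H) : Type u := (1 - p).ker

instance instNormedAddCommGroupFixedSpace (p : H →L[ℂ] H) : NormedAddCommGroup (FixedSpace p) :=
  inferInstanceAs (NormedAddCommGroup (1 - p).ker)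

instance instInnerProductSpaceFixedSpace (p : H →L[ℂ] H) : InnerProductSpace ℂ (FixedSpace p) :=
  inferInstanceAs (InnerProductSpace ℂ (1 - p).ker)

instance instCompleteSpaceFixedSpace (p : H →L[ℂ] H) : CompleteSpace (FixedSpace p) :=
  ContinuousLinearMap.completeSpace_ker (1 - p)

/-- The inclusion of `pH` into `H`. -/
def incl (p : H →L[ℂ] H) : FixedSpace p →L[ℂ] H :=
  LinearIsometry.toContinuousLinearMap
    { toFun := fun v => Subtype.val v
      map_add' := fun _ _ => rfl
      map_smul' := fun _ _ => rfl
      norm_map' := fun _ => rfl }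

theorem norm_incl_apply (p : H →L[ℂ] H) (v : FixedSpace p) : ‖incl p v‖ = ‖v‖ := rfl

theorem norm_incl_le (p : H →L[ℂ] H) : ‖incl p‖ ≤ 1 :=
  ContinuousLinearMap.opNorm_le_bound _ zero_le_one fun v => by rw [norm_incl_apply, one_mul]

theorem norm_adjoint_incl_le (p : H →L[ℂ] H) : ‖(incl p).adjoint‖ ≤ 1 := by
  rw [LinearIsometryEquiv.norm_map]
  exact norm_incl_le p

theorem apply_incl (p : H →L[ℂ] H) (v : FixedSpace p) : p (incl p v) = incl p v := by
  have h : (1 - p) (incl p v) = 0 := LinearMap.mem_ker.mp (Subtype.property v)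
  exact (sub_eq_zero.mp h).symm

theorem adjoint_incl_comp_incl (p : H →L[ℂ] H) : (incl p).adjoint ∘L incl p = 1 :=
  (ContinuousLinearMap.norm_map_iff_adjoint_comp_self _).mp (norm_incl_apply p)

theorem incl_comp_adjoint_incl {p : H →L[ℂ] H} (hp : IsStarProjection p) :
    incl p ∘L (incl p).adjoint = p := by
  have h1 : p ∘L incl p = incl p := ContinuousLinearMap.ext (apply_incl p)
  have h2 : (incl p).adjoint ∘L p = (incl p).adjoint := by
    have h := congrArg ContinuousLinearMap.adjoint h1
    rwa [ContinuousLinearMap.adjoint_comp, ← ContinuousLinearMap.star_eq_adjoint p,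
      hp.isSelfAdjoint.star_eq] at h
  ext v
  have hv : p (p v) = p v := congrArg (fun T : H →L[ℂ] H => T v) hp.isIdempotentElem.eq
  let w : FixedSpace p := ⟨p v, LinearMap.mem_ker.mpr (sub_eq_zero.mpr hv.symm)⟩
  have hw : incl p w = p v := rfl
  calc incl p ((incl p).adjoint v) = incl p (((incl p).adjoint ∘L p) v) := by rw [h2]
    _ = incl p (((incl p).adjoint ∘L incl p) w) := by
        rw [ContinuousLinearMap.comp_apply, ContinuousLinearMap.comp_apply, hw]
    _ = p v := by rw [adjoint_incl_comp_incl, ← hw]; rfl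

/-- The extension of an operator on `pH` to `H` by zero on the orthogonal complement. -/
def extend (p : H →L[ℂ] H) (x : FixedSpace p →L[ℂ] FixedSpace p) : H →L[ℂ] H :=
  incl p ∘L x ∘L (incl p).adjoint

/-- The compression of an operator on `H` to an operator on `pH`. -/
def restrict (p : H →L[ℂ] H) (x : H →L[ℂ] H) : FixedSpace p →L[ℂ] FixedSpace p :=
  (incl p).adjoint ∘L x ∘L incl p

theorem norm_restrict_le (p : H →L[ℂ] H) (x : H →L[ℂ] H) : ‖restrict p x‖ ≤ ‖x‖ :=
  calc ‖restrict p x‖ ≤ ‖(incl p).adjoint‖ * (‖x‖ * ‖incl p‖) :=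
        (ContinuousLinearMap.opNorm_comp_le _ _).trans
          (mul_le_mul_of_nonneg_left (ContinuousLinearMap.opNorm_comp_le _ _) (norm_nonneg _))
    _ ≤ 1 * (‖x‖ * 1) := by
        gcongr
        · exact norm_adjoint_incl_le p
        · exact norm_incl_le p
    _ = ‖x‖ := by ring

theorem norm_extend_le (p : H →L[ℂ] H) (x : FixedSpace p →L[ℂ] FixedSpace p) :
    ‖extend p x‖ ≤ ‖x‖ :=
  calc ‖extend p x‖ ≤ ‖incl p‖ * (‖x‖ * ‖(incl p).adjoint‖) :=
        (ContinuousLinearMap.opNorm_comp_le _ _).trans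
          (mul_le_mul_of_nonneg_left (ContinuousLinearMap.opNorm_comp_le _ _) (norm_nonneg _))
    _ ≤ 1 * (‖x‖ * 1) := by
        gcongr
        · exact norm_incl_le p
        · exact norm_adjoint_incl_le p
    _ = ‖x‖ := by ring

theorem adjoint_incl_incl (p : H →L[ℂ] H) (v : FixedSpace p) :
    (incl p).adjoint (incl p v) = v :=
  congrArg (fun T : FixedSpace p →L[ℂ] FixedSpace p => T v) (adjoint_incl_comp_incl p)

theorem incl_adjoint_incl {p : H →L[ℂ] H} (hp : IsStarProjection p) (v : H) :
    incl p ((incl p).adjoint v) = p v :=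
  congrArg (fun T : H →L[ℂ] H => T v) (incl_comp_adjoint_incl hp)

theorem restrict_extend (p : H →L[ℂ] H) (x : FixedSpace p →L[ℂ] FixedSpace p) :
    restrict p (extend p x) = x := by
  ext v
  simp [restrict, extend, adjoint_incl_incl]

theorem extend_restrict {p : H →L[ℂ] H} (hp : IsStarProjection p) (x : H →L[ℂ] H) :
    extend p (restrict p x) = p * x * p := by
  ext v
  simp [restrict, extend, incl_adjoint_incl hp]

theorem extend_mul (p : H →L[ℂ] H) (x y : FixedSpace p →L[ℂ] FixedSpace p) :
    extend p (x * y) = extend p x * extend p y := by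
  ext v
  simp [extend, adjoint_incl_incl]

theorem extend_add (p : H →L[ℂ] H) (x y : FixedSpace p →L[ℂ] FixedSpace p) :
    extend p (x + y) = extend p x + extend p y := by
  ext v
  simp [extend]

theorem extend_smul (p : H →L[ℂ] H) (r : ℂ) (x : FixedSpace p →L[ℂ] FixedSpace p) :
    extend p (r • x) = r • extend p x := by
  ext v
  simp [extend]

theorem extend_star (p : H →L[ℂ] H) (x : FixedSpace p →L[ℂ] FixedSpace p) :
    extend p (star x) = star (extend p x) := by
  simp only [extend, ContinuousLinearMap.star_eq_adjoint, ContinuousLinearMap.adjoint_comp,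
    ContinuousLinearMap.adjoint_adjoint, ContinuousLinearMap.comp_assoc]

theorem extend_injective (p : H →L[ℂ] H) : Function.Injective (extend p) :=
  Function.LeftInverse.injective (restrict_extend p)

theorem mul_extend (p : H →L[ℂ] H) (x : FixedSpace p →L[ℂ] FixedSpace p) :
    p * extend p x = extend p x := by
  ext v
  exact apply_incl p _

theorem extend_mul_self {p : H →L[ℂ] H} (hp : IsStarProjection p)
    (x : FixedSpace p →L[ℂ] FixedSpace p) : extend p x * p = extend p x := by
  have h := congrArg star (mul_extend p (star x))
  rwa [star_mul, extend_star, star_star, hp.isSelfAdjoint.star_eq] at h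

theorem coe_isStarProjection {A : VonNeumannAlgebra H} {p : A.Elem} (hp : IsStarProjection p) :
    IsStarProjection (p : H →L[ℂ] H) :=
  ⟨congrArg Elem.op hp.isIdempotentElem.eq, congrArg Elem.op hp.isSelfAdjoint.star_eq⟩

/-- The operators on `pH` whose extension by zero lies in `A` are exactly those that commute with
the restrictions to `pH` of the operators in the commutant of `A`. -/
theorem setOf_extend_mem_eq (A : VonNeumannAlgebra H) {p : H →L[ℂ] H} (hp : IsStarProjection p)
    (hpA : p ∈ A) :
    {x | extend p x ∈ A} =
      Set.centralizer (restrict p '' Set.centralizer (A : Set (H →L[ℂ] H))) := by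
  ext x
  rw [Set.mem_ofPred_eq, Set.mem_centralizer_iff, Set.forall_mem_image]
  have key : ∀ y ∈ Set.centralizer (A : Set (H →L[ℂ] H)),
      extend p (restrict p y * x) = y * extend p x ∧
      extend p (x * restrict p y) = extend p x * y := by
    intro y hy
    have hc : p * y = y * p := Set.mem_centralizer_iff.mp hy p hpA
    constructor
    · rw [extend_mul, extend_restrict hp, hc, mul_assoc, mul_assoc, mul_extend p, mul_extend p]
    · rw [extend_mul, extend_restrict hp, mul_assoc, ← hc, ← mul_assoc, ← mul_assoc,
        extend_mul_self hp, extend_mul_self hp]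
  constructor
  · intro hx y hy
    apply extend_injective p
    rw [(key y hy).1, (key y hy).2]
    exact (Set.mem_centralizer_iff.mp hy _ hx).symm
  · intro hx
    rw [← SetLike.mem_coe, ← A.centralizer_centralizer, Set.mem_centralizer_iff]
    intro y hy
    rw [← (key y hy).1, ← (key y hy).2, hx hy]

/-- For a projection `p` of `A`, the von Neumann algebra `pAp`, realised on the Hilbert space
`pH`: it consists of the operators on `pH` whose extension by zero belongs to `A`. -/
def cornerAlgebra (A : VonNeumannAlgebra H) (p : A.Elem) (hp : IsStarProjection p) :
    VonNeumannAlgebra (FixedSpace (p : H →L[ℂ] H)) where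
  carrier := {x | extend (p : H →L[ℂ] H) x ∈ A}
  mul_mem' {x y} hx hy := by
    change extend _ _ ∈ A
    rw [extend_mul]
    exact mul_mem hx hy
  add_mem' {x y} hx hy := by
    change extend _ _ ∈ A
    rw [extend_add]
    exact add_mem hx hy
  algebraMap_mem' r := by
    change extend _ _ ∈ A
    have : extend (p : H →L[ℂ] H) (algebraMap ℂ _ r) = r • (p : H →L[ℂ] H) := by
      ext v
      simp [extend, Algebra.algebraMap_eq_smul_one, incl_adjoint_incl (coe_isStarProjection hp)]
    rw [this]
    exact SMulMemClass.smul_mem r p.op_mem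
  star_mem' {x} hx := by
    change extend _ _ ∈ A
    rw [extend_star]
    exact star_mem hx
  centralizer_centralizer' := by
    rw [setOf_extend_mem_eq A (coe_isStarProjection hp) p.op_mem,
      Set.centralizer_centralizer_centralizer]

theorem restrict_add (p x y : H →L[ℂ] H) : restrict p (x + y) = restrict p x + restrict p y := by
  ext v
  simp [restrict]

theorem restrict_smul (p : H →L[ℂ] H) (r : ℂ) (x : H →L[ℂ] H) :
    restrict p (r • x) = r • restrict p x := by
  ext v
  simp [restrict]

theorem restrict_mem {A : VonNeumannAlgebra H} {p : A.Elem} (hp : IsStarProjection p)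
    (x : A.Elem) : restrict (p : H →L[ℂ] H) x ∈ A.cornerAlgebra p hp := by
  change extend (p : H →L[ℂ] H) (restrict (p : H →L[ℂ] H) x) ∈ A
  rw [extend_restrict (coe_isStarProjection hp)]
  exact mul_mem (mul_mem p.op_mem x.op_mem) p.op_mem

theorem extend_mem {A : VonNeumannAlgebra H} {p : A.Elem} {hp : IsStarProjection p}
    (y : (A.cornerAlgebra p hp).Elem) : extend (p : H →L[ℂ] H) y ∈ A := y.op_mem

/-- The standard corner `A → pAp`, `x ↦ pxp`, of a projection `p` of `A`. -/
def standardCorner {A : VonNeumannAlgebra H} (p : A.Elem) (hp : IsStarProjection p) :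
    A.Elem →L[ℂ] (A.cornerAlgebra p hp).Elem :=
  LinearMap.mkContinuous
    { toFun := fun x => Elem.mk (restrict (p : H →L[ℂ] H) x) (restrict_mem hp x)
      map_add' := fun x y => Elem.ext_op (restrict_add _ _ _)
      map_smul' := fun r x => Elem.ext_op (restrict_smul _ _ _) } 1
    (fun x => by
      rw [one_mul]
      exact norm_restrict_le _ _)

/-- The inclusion of `pAp` into `A`. -/
def cornerInclusion {A : VonNeumannAlgebra H} (p : A.Elem) (hp : IsStarProjection p) :
    (A.cornerAlgebra p hp).Elem →L[ℂ] A.Elem :=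
  LinearMap.mkContinuous
    { toFun := fun y => Elem.mk (extend (p : H →L[ℂ] H) y) (extend_mem y)
      map_add' := fun x y => Elem.ext_op (extend_add _ _ _)
      map_smul' := fun r x => Elem.ext_op (extend_smul _ _ _) } 1
    (fun x => by
      rw [one_mul]
      exact norm_extend_le _ _)

/-- The standard compression `qAq → A`, `y ↦ √a y √a`, of a positive element `a` of `A`, where the
projection `q` is meant to be the support projection `⌈a⌉`. -/
def standardCompression {A : VonNeumannAlgebra H} (a q : A.Elem) (hq : IsStarProjection q) :
    (A.cornerAlgebra q hq).Elem →L[ℂ] A.Elem :=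
  ContinuousLinearMap.mulLeftRight ℂ A.Elem (CFC.sqrt a) (CFC.sqrt a) ∘L cornerInclusion q hq

/-! ### Pure maps -/

/-- `p` is the carrier of `φ`: the least projection with `φ p = φ 1`. -/
def IsCarrier {A : VonNeumannAlgebra H} {B : VonNeumannAlgebra K} (φ : A.Elem →L[ℂ] B.Elem) (p : A.Elem) : Prop :=
  IsLeast {r : A.Elem | IsStarProjection r ∧ φ r = φ 1} p

/-- `q` is the support projection `⌈a⌉` of the effect `a`: the least projection above `a`. -/
def IsSupport {A : VonNeumannAlgebra H} (a q : A.Elem) : Prop :=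
  IsLeast {r : A.Elem | IsStarProjection r ∧ a ≤ r} q

/-- The contractive map obtained from `φ` by dividing by its norm; a map that is contractive
already is left alone. -/
def normalize {A : VonNeumannAlgebra H} {B : VonNeumannAlgebra K} (φ : A.Elem →L[ℂ] B.Elem) : A.Elem →L[ℂ] B.Elem :=
  (((max 1 ‖φ‖)⁻¹ : ℝ) : ℂ) • φ

/-- For a contractive NCP-map `φ : A → B` with carrier `p` and with `q = ⌈φ(1)⌉`, this says that the
NCP-map `ψ : pAp → qBq` is the (unique) middle part of `φ`, i.e. that `φ` is the composite of the
standard corner of `p`, the map `ψ`, and the standard compression of `φ(1)`. -/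
structure IsMiddlePart {A : VonNeumannAlgebra H} {B : VonNeumannAlgebra K} (φ : A.Elem →L[ℂ] B.Elem)
    {p : A.Elem} {q : B.Elem} (hp : IsStarProjection p) (hq : IsStarProjection q)
    (ψ : (A.cornerAlgebra p hp).Elem →L[ℂ] (B.cornerAlgebra q hq).Elem) : Prop where
  isCarrier : IsCarrier φ p
  isSupport : IsSupport (φ 1) q
  isNCP : IsNCP ψ
  factor : (standardCompression (φ 1) q hq).comp (ψ.comp (standardCorner p hp)) = φ

/-- An NCP-map is pure if the middle part of (the normalisation of) it is an isomorphism. -/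
def IsPure {A : VonNeumannAlgebra H} {B : VonNeumannAlgebra K} (φ : A.Elem →L[ℂ] B.Elem) : Prop :=
  IsNCP φ ∧ ∃ (p : A.Elem) (q : B.Elem) (hp : IsStarProjection p) (hq : IsStarProjection q)
    (ψ : (A.cornerAlgebra p hp).Elem →L[ℂ] (B.cornerAlgebra q hq).Elem),
    IsMiddlePart (normalize φ) hp hq ψ ∧ IsNCPIso ψ

end VonNeumannAlgebra

end

/-! Corners. If `h` is a corner for `a`, let `m` be the range projection of `1 - a`. Normality gives
`h m = 0`, so `h` only sees `(1 - m)A(1 - m)`, and the universal property applied to the standard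
corner of `1 - m` yields a section `σ` of `h` that sends effects below `a`
(`IsCornerFor.exists_section`). The composite of a corner for `a` with a corner for `b` is then a
corner for `σ b`.

Compressions. A compression `c` for `a` maps the effects of its domain bijectively onto the effects
below `a` and reflects their order (`IsCompressionFor.exists_effect`, `IsCompressionFor.effect_ext`,
`IsCompressionFor.le_of_map_le`). So if `ψ` is a compression and `φ` is one for `b`, the composite
is a compression for `ψ b`: a map `g` with `g 1 ≤ ψ b` factors through `ψ` as some `k`, and `k 1 ≤
b` by order reflection.

Pure maps. Purity is equivalent to having the form `x ↦ t⋆ α(x) t`, where `α` restricts to an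
isomorphism `pAp → eBe` (`IsPure.hasPureForm`, `HasPureForm.isPure`). Such an `α` is multiplicative
on `pAp` (`IsPartialIso.map_mul`). In a composite `s⋆ β(t⋆ α(x) t) s`, with `β` defined on `qBq`,
only `r = e t q` matters. The polar decomposition `r = u a` turns `r⋆ α(x) r` into `a γ(x) a`, where
`γ` is `α` conjugated by `u` and ends in a corner below `q`. Multiplicativity of `β` then pulls out
`β(a)`, leaving the partial isomorphism `β ∘ γ` conjugated by `β(a) s` (`HasPureForm.comp`).

Complete positivity and normality of the auxiliary maps are checked on quadratic forms. The
bicommutant property supplies the weak limits and polar decompositions inside the algebra. -/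

namespace VonNeumannAlgebra

variable {H K : Type u} [NormedAddCommGroup H] [InnerProductSpace ℂ H] [CompleteSpace H]
  [NormedAddCommGroup K] [InnerProductSpace ℂ K] [CompleteSpace K]

open scoped InnerProductSpace
open RCLike (re)

/-! ### Quadratic forms of elements -/

section Order

variable {A : VonNeumannAlgebra H}

namespace Elem

theorem isSelfAdjoint_op {x : A.Elem} (hx : IsSelfAdjoint x) :
    IsSelfAdjoint (x : H →L[ℂ] H) := congrArg Elem.op hx

theorem inner_op_left (x : A.Elem) (v w : H) : ⟪x.op v, w⟫_ℂ = ⟪v, (star x).op w⟫_ℂ := by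
  rw [op_star, ContinuousLinearMap.star_eq_adjoint, ContinuousLinearMap.adjoint_inner_right]

theorem inner_op_right (x : A.Elem) (v w : H) : ⟪v, x.op w⟫_ℂ = ⟪(star x).op v, w⟫_ℂ := by
  rw [inner_op_left, star_star]

theorem op_mul_apply (x y : A.Elem) (v : H) : (x * y).op v = x.op (y.op v) := rfl

/-- The quadratic form `v ↦ Re ⟨x v, v⟩` of an element of a von Neumann algebra. -/
noncomputable def form (x : A.Elem) (v : H) : ℝ := re ⟪x.op v, v⟫_ℂ

theorem form_sub (x y : A.Elem) (v : H) : (x - y).form v = x.form v - y.form v := by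
  simp [form, op_sub]

theorem form_star_mul_self (x : A.Elem) (v : H) : (star x * x).form v = ‖x.op v‖ ^ 2 := by
  rw [form, op_mul_apply, inner_op_left, star_star, inner_self_eq_norm_sq (𝕜 := ℂ)]

theorem form_nonneg {x : A.Elem} (hx : 0 ≤ x) (v : H) : 0 ≤ x.form v := by
  obtain ⟨y, rfl⟩ := CStarAlgebra.nonneg_iff_eq_star_mul_self.mp hx
  rw [form_star_mul_self]
  positivity

theorem form_mono {x y : A.Elem} (h : x ≤ y) (v : H) : x.form v ≤ y.form v := by
  have := form_nonneg (sub_nonneg.mpr h) v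
  rw [form_sub] at this
  linarith

theorem nonneg_of_form {x : A.Elem} (hx : IsSelfAdjoint x) (h : ∀ v, 0 ≤ x.form v) : 0 ≤ x := by
  rw [← op_le_op, op_zero, ContinuousLinearMap.nonneg_iff_isPositive,
    ContinuousLinearMap.isPositive_def']
  exact ⟨isSelfAdjoint_op hx, h⟩

theorem le_of_form {x y : A.Elem} (hx : IsSelfAdjoint x) (hy : IsSelfAdjoint y)
    (h : ∀ v, x.form v ≤ y.form v) : x ≤ y :=
  sub_nonneg.mp <| nonneg_of_form (hy.sub hx) fun v => by
    rw [form_sub]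
    linarith [h v]

theorem ext_apply {x y : A.Elem} (h : ∀ v, x.op v = y.op v) : x = y :=
  ext_op (ContinuousLinearMap.ext h)

end Elem

end Order

/-! ### Positivity of matrices over a von Neumann algebra -/

theorem exists_eq_star_mul_self_of_nonneg {X : Type*} [NonUnitalCStarAlgebra X] [PartialOrder X]
    [StarOrderedRing X] {x : X} (hx : 0 ≤ x) : ∃ y, x = star y * y :=
  CStarAlgebra.nonneg_iff_eq_star_mul_self.mp hx

/-- This is the decomposition into orthogonal positive and negative parts, with the negative part
written as a square so that it can be tested against a quadratic form. -/
theorem exists_pos_sub_star_mul_self {X : Type*} [NonUnitalCStarAlgebra X] [PartialOrder X]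
    [StarOrderedRing X] {x : X} (hx : IsSelfAdjoint x) :
    ∃ y s : X, 0 ≤ y ∧ x = y - star s * s ∧ star s * s * y = 0 := by
  obtain ⟨s, hs⟩ := exists_eq_star_mul_self_of_nonneg (CFC.negPart_nonneg x)
  refine ⟨x⁺, s, CFC.posPart_nonneg x, ?_, ?_⟩
  · rw [← hs, CFC.posPart_sub_negPart x hx]
  · rw [← hs, CFC.negPart_mul_posPart]

theorem eq_zero_of_star_mul_self_eq_zero {X : Type*} [NonUnitalCStarAlgebra X] {x : X}
    (hx : star x * x = 0) : x = 0 := CStarRing.star_mul_self_eq_zero_iff x |>.mp hx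

section Matrix

variable {A : VonNeumannAlgebra H} {k : ℕ}

/-- The quadratic form on `Hᵏ` of a `k × k` matrix over a von Neumann algebra on `H`. -/
noncomputable def matrixForm (M : CStarMatrix (Fin k) (Fin k) A.Elem) (v : Fin k → H) : ℂ :=
  ∑ i, ∑ j, ⟪v i, (M i j).op (v j)⟫_ℂ

/-- The action of a `k × k` matrix over a von Neumann algebra on `Hᵏ`. -/
noncomputable def matrixApply (M : CStarMatrix (Fin k) (Fin k) A.Elem) (v : Fin k → H)
    (i : Fin k) : H :=
  ∑ j, (M i j).op (v j)

theorem op_sum_apply {ι : Type*} (s : Finset ι) (f : ι → A.Elem) (v : H) :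
    (∑ i ∈ s, f i).op v = ∑ i ∈ s, (f i).op v := by
  classical
  induction s using Finset.induction_on with
  | empty => rfl
  | insert a s ha ih => rw [Finset.sum_insert ha, Finset.sum_insert ha, Elem.op_add,
      add_apply, ih]

theorem matrixForm_eq (M : CStarMatrix (Fin k) (Fin k) A.Elem) (v : Fin k → H) :
    matrixForm M v = ∑ i, ⟪v i, matrixApply M v i⟫_ℂ := by
  simp only [matrixForm, matrixApply, inner_sum]

theorem matrixApply_mul (M N : CStarMatrix (Fin k) (Fin k) A.Elem) (v : Fin k → H) :
    matrixApply (M * N) v = matrixApply M (matrixApply N v) := by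
  ext i
  simp only [matrixApply, CStarMatrix.mul_apply, op_sum_apply, map_sum, Elem.op_mul_apply]
  exact Finset.sum_comm

theorem sum_inner_matrixApply_star (M : CStarMatrix (Fin k) (Fin k) A.Elem) (v w : Fin k → H) :
    ∑ i, ⟪v i, matrixApply (star M) w i⟫_ℂ = ∑ i, ⟪matrixApply M v i, w i⟫_ℂ := by
  simp only [matrixApply, inner_sum, sum_inner, CStarMatrix.star_apply, Elem.inner_op_left]
  exact Finset.sum_comm

theorem matrixForm_star_mul_mul (M N : CStarMatrix (Fin k) (Fin k) A.Elem) (v : Fin k → H) :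
    matrixForm (star N * M * N) v = matrixForm M (matrixApply N v) := by
  rw [matrixForm_eq, matrixForm_eq, mul_assoc, matrixApply_mul, sum_inner_matrixApply_star,
    matrixApply_mul]

theorem matrixForm_star_mul_self (N : CStarMatrix (Fin k) (Fin k) A.Elem) (v : Fin k → H) :
    matrixForm (star N * N) v = ((∑ i, ‖matrixApply N v i‖ ^ 2 : ℝ) : ℂ) := by
  rw [matrixForm_eq, matrixApply_mul, sum_inner_matrixApply_star]
  push_cast
  exact Finset.sum_congr rfl fun i _ => inner_self_eq_norm_sq_to_K _

theorem matrixForm_nonneg {M : CStarMatrix (Fin k) (Fin k) A.Elem} (hM : 0 ≤ M) (v : Fin k → H) :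
    0 ≤ (matrixForm M v).re := by
  obtain ⟨N, rfl⟩ := exists_eq_star_mul_self_of_nonneg hM
  rw [matrixForm_star_mul_self, Complex.ofReal_re]
  positivity

theorem eq_zero_of_matrixApply_eq_zero {M : CStarMatrix (Fin k) (Fin k) A.Elem}
    (h : ∀ v, matrixApply M v = 0) : M = 0 := by
  ext i j
  refine Elem.ext_apply fun v => ?_
  have := congrFun (h (Pi.single j v)) i
  rw [matrixApply, Finset.sum_eq_single j] at this
  · simpa using! this
  · intro l _ hl
    rw [Pi.single_eq_of_ne hl, map_zero]
  · simp

theorem matrixForm_neg (M : CStarMatrix (Fin k) (Fin k) A.Elem) (v : Fin k → H) :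
    matrixForm (-M) v = -matrixForm M v := by
  simp only [matrixForm, CStarMatrix.neg_apply, ← Finset.sum_neg_distrib, ← inner_neg_right]
  rfl

/-- Testing the form on vectors in the range of the negative part `N = S⋆S` forces that part to
vanish: there `M` acts as `-N`, so the form of `NMN = -(SN)⋆(SN)` is both nonnegative and
nonpositive. Hence `SN = 0`, and `N² = S⋆(SN) = 0`. -/
theorem nonneg_of_matrixForm {M : CStarMatrix (Fin k) (Fin k) A.Elem} (hM : IsSelfAdjoint M)
    (h : ∀ v, 0 ≤ (matrixForm M v).re) : 0 ≤ M := by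
  obtain ⟨P, S, hP, hMP, hSP⟩ := exists_pos_sub_star_mul_self hM
  set N := star S * S with hN
  have hNs : star N = N := by rw [hN, star_mul, star_star]
  have h1 : star N * M * N = -(star (S * N) * (S * N)) := by
    rw [hNs, star_mul S N, hNs, hMP, mul_sub, hSP, zero_sub, neg_mul, mul_assoc N (star S),
      ← mul_assoc (star S), ← hN, mul_assoc]
  have h3 : S * N = 0 := by
    refine eq_zero_of_matrixApply_eq_zero fun v => ?_
    have h4 := h (matrixApply N v)
    rw [← matrixForm_star_mul_mul, h1, matrixForm_neg, matrixForm_star_mul_self, Complex.neg_re,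
      Complex.ofReal_re] at h4
    have h5 : ∑ i, ‖matrixApply (S * N) v i‖ ^ 2 = 0 :=
      le_antisymm (by linarith) (by positivity)
    rw [Finset.sum_eq_zero_iff_of_nonneg (fun i _ => by positivity)] at h5
    ext i
    simpa using h5 i (Finset.mem_univ i)
  have h6 : N = 0 := eq_zero_of_star_mul_self_eq_zero (by
    rw [hNs]
    nth_rewrite 1 [hN]
    rw [mul_assoc, h3, mul_zero])
  rwa [hMP, h6, sub_zero]

end Matrix

/-! ### Consequences of complete positivity -/

section CompletelyPositive

variable {A : VonNeumannAlgebra H} {B : VonNeumannAlgebra K}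

theorem IsNCP.map_matrix_nonneg {φ : A.Elem →L[ℂ] B.Elem} (hφ : IsNCP φ) {k : ℕ}
    {M : CStarMatrix (Fin k) (Fin k) A.Elem} (hM : 0 ≤ M) : 0 ≤ M.map φ := by
  obtain ⟨ψ, hψ⟩ := hφ.completelyPositive
  have h := ψ.map_cstarMatrix_nonneg M hM
  rwa [show (ψ : A.Elem → B.Elem) = φ from funext hψ] at h

theorem IsNCP.map_nonneg {φ : A.Elem →L[ℂ] B.Elem} (hφ : IsNCP φ) {x : A.Elem} (hx : 0 ≤ x) :
    0 ≤ φ x := by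
  obtain ⟨ψ, hψ⟩ := hφ.completelyPositive
  rw [← hψ x, ← map_zero ψ]
  exact OrderHomClass.mono ψ hx

theorem IsNCP.monotone {φ : A.Elem →L[ℂ] B.Elem} (hφ : IsNCP φ) : Monotone φ := fun x y h => by
  rw [← sub_nonneg, ← map_sub]
  exact hφ.map_nonneg (sub_nonneg.mpr h)

theorem map_isSelfAdjoint_of_map_nonneg {φ : A.Elem →L[ℂ] B.Elem}
    (hφ : ∀ x, 0 ≤ x → 0 ≤ φ x) {x : A.Elem} (hx : IsSelfAdjoint x) : IsSelfAdjoint (φ x) := by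
  rw [← CFC.posPart_sub_negPart x hx, map_sub]
  exact (IsSelfAdjoint.of_nonneg (hφ _ (CFC.posPart_nonneg x))).sub
    (IsSelfAdjoint.of_nonneg (hφ _ (CFC.negPart_nonneg x)))

theorem map_star_of_map_nonneg {φ : A.Elem →L[ℂ] B.Elem}
    (hφ : ∀ x, 0 ≤ x → 0 ≤ φ x) (x : A.Elem) : φ (star x) = star (φ x) := by
  have h1 := (map_isSelfAdjoint_of_map_nonneg hφ (realPart x).2).star_eq
  have h2 := (map_isSelfAdjoint_of_map_nonneg hφ (imaginaryPart x).2).star_eq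
  conv_lhs => rw [← realPart_add_I_smul_imaginaryPart x]
  conv_rhs => rw [← realPart_add_I_smul_imaginaryPart x]
  simp only [star_add, star_smul, map_add, map_smul, h1, h2, (realPart x).2.star_eq,
    (imaginaryPart x).2.star_eq]

theorem IsNCP.isSelfAdjoint {φ : A.Elem →L[ℂ] B.Elem} (hφ : IsNCP φ) {x : A.Elem}
    (hx : IsSelfAdjoint x) : IsSelfAdjoint (φ x) :=
  map_isSelfAdjoint_of_map_nonneg (fun _ => hφ.map_nonneg) hx

theorem IsNCP.map_star {φ : A.Elem →L[ℂ] B.Elem} (hφ : IsNCP φ) (x : A.Elem) :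
    φ (star x) = star (φ x) :=
  map_star_of_map_nonneg (fun _ => hφ.map_nonneg) x

/-- A map is completely positive if it sends positive matrices to matrices with nonnegative
quadratic form. -/
theorem exists_completelyPositive_of_form {φ : A.Elem →L[ℂ] B.Elem}
    (hφ : ∀ x, 0 ≤ x → 0 ≤ φ x)
    (h : ∀ (k : ℕ) (M : CStarMatrix (Fin k) (Fin k) A.Elem), 0 ≤ M →
      ∀ v, 0 ≤ (matrixForm (M.map φ) v).re) :
    ∃ ψ : A.Elem →CP B.Elem, ∀ x, ψ x = φ x := by
  refine ⟨{ toLinearMap := φ.toLinearMap, map_cstarMatrix_nonneg' := fun k M hM => ?_ },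
    fun _ => rfl⟩
  refine nonneg_of_matrixForm ?_ (h k M hM)
  ext i j
  have hs : star (M j i) = M i j := by
    rw [← CStarMatrix.star_apply, (IsSelfAdjoint.of_nonneg hM).star_eq]
  rw [CStarMatrix.star_apply, CStarMatrix.map_apply, CStarMatrix.map_apply, ← hs]
  exact (map_star_of_map_nonneg hφ _).symm

/-- The Kadison-Schwarz inequality. -/
theorem IsNCP.star_map_mul_map_le {φ : A.Elem →L[ℂ] B.Elem} (hφ : IsNCP φ) (h1 : φ 1 ≤ 1)
    (x : A.Elem) : star (φ x) * φ x ≤ φ (star x * x) := by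
  -- `N⋆N` has rows `(x⋆x, x⋆)` and `(x, 1)`. Its image under `φ` is tested on `(v, -φ(x)v)`, where
  -- the two cross terms give `-2‖φ(x)v‖²` and the last entry at most `‖φ(x)v‖²`.
  let N : CStarMatrix (Fin 2) (Fin 2) A.Elem := CStarMatrix.ofMatrix !![x, 1; 0, 0]
  have hM := hφ.map_matrix_nonneg (star_mul_self_nonneg N)
  refine Elem.le_of_form (.star_mul_self _) (hφ.isSelfAdjoint (.star_mul_self _)) fun v => ?_
  have h := matrixForm_nonneg hM ![v, -(φ x).op v]
  have e00 : (star N * N) 0 0 = star x * x := by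
    simp [N, CStarMatrix.mul_apply, CStarMatrix.star_apply]
  have e01 : (star N * N) 0 1 = star x := by
    simp [N, CStarMatrix.mul_apply, CStarMatrix.star_apply]
  have e10 : (star N * N) 1 0 = x := by
    simp [N, CStarMatrix.mul_apply, CStarMatrix.star_apply]
  have e11 : (star N * N) 1 1 = 1 := by
    simp [N, CStarMatrix.mul_apply, CStarMatrix.star_apply]
  simp only [matrixForm, Fin.sum_univ_two, CStarMatrix.map_apply, e00, e01, e10, e11] at h
  simp only [Matrix.cons_val_zero, Matrix.cons_val_one, hφ.map_star, map_neg, inner_neg_left,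
    inner_neg_right, neg_neg, Complex.add_re, Complex.neg_re] at h
  have h2 : (⟪v, (star (φ x)).op ((φ x).op v)⟫_ℂ).re = ‖(φ x).op v‖ ^ 2 := by
    rw [← Elem.inner_op_left]
    exact inner_self_eq_norm_sq (𝕜 := ℂ) _
  have h3 : (⟪(φ x).op v, (φ x).op v⟫_ℂ).re = ‖(φ x).op v‖ ^ 2 :=
    inner_self_eq_norm_sq (𝕜 := ℂ) _
  have h4 : (⟪(φ x).op v, (φ 1).op ((φ x).op v)⟫_ℂ).re ≤ ‖(φ x).op v‖ ^ 2 := by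
    have := Elem.form_mono h1 ((φ x).op v)
    rw [Elem.form, Elem.form, Elem.op_one, one_apply_eq_self,
      inner_self_eq_norm_sq (𝕜 := ℂ), inner_re_symm (𝕜 := ℂ)] at this
    exact this
  have h5 : (⟪v, (φ (star x * x)).op v⟫_ℂ).re = (φ (star x * x)).form v :=
    inner_re_symm (𝕜 := ℂ) _ _
  rw [Elem.form_star_mul_self]
  linarith

end CompletelyPositive

/-! ### Suprema of directed sets are weak limits -/

section Normal

open Filter Topology

variable {A : VonNeumannAlgebra H} {B : VonNeumannAlgebra K}

theorem Elem.mem_of_commute_commutant (A : VonNeumannAlgebra H) {t : H →L[ℂ] H}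
    (h : ∀ y : H →L[ℂ] H, (∀ a : A.Elem, a.op * y = y * a.op) → y * t = t * y) : t ∈ A := by
  rw [← SetLike.mem_coe, ← A.centralizer_centralizer, Set.mem_centralizer_iff]
  intro y hy
  exact h y fun a => Set.mem_centralizer_iff.mp hy _ a.op_mem

theorem Elem.commute_star_commutant {y : H →L[ℂ] H} (hy : ∀ a : A.Elem, a.op * y = y * a.op)
    (a : A.Elem) : a.op * star y = star y * a.op := by
  have := congrArg star (hy (star a))
  rw [star_mul, star_mul, Elem.op_star, star_star] at this
  exact this.symm

/-- A bounded family of operators in a von Neumann algebra has a weak limit along an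
ultrafilter. -/
theorem exists_weak_limit {ι : Type*} (U : Ultrafilter ι) (f : ι → A.Elem) (c : ℝ)
    (hf : ∀ᶠ i in U, ‖f i‖ ≤ c) :
    ∃ t : A.Elem, ∀ v w, Tendsto (fun i => ⟪(f i).op v, w⟫_ℂ) U (𝓝 ⟪t.op v, w⟫_ℂ) := by
  have hlim : ∀ v w : H, ∃ z : ℂ, ‖z‖ ≤ c * ‖v‖ * ‖w‖ ∧
      Tendsto (fun i => ⟪(f i).op v, w⟫_ℂ) U (𝓝 z) := by
    intro v w
    have hb : ∀ᶠ i in U, ⟪(f i).op v, w⟫_ℂ ∈ Metric.closedBall (0 : ℂ) (c * ‖v‖ * ‖w‖) := by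
      filter_upwards [hf] with i hi
      rw [mem_closedBall_zero_iff]
      refine (norm_inner_le_norm _ _).trans ?_
      gcongr
      refine ((f i).op.le_opNorm v).trans ?_
      rw [Elem.norm_op]
      gcongr
    obtain ⟨z, hz, hzU⟩ := (isCompact_closedBall (0 : ℂ) (c * ‖v‖ * ‖w‖)).ultrafilter_le_nhds
      (U.map fun i => ⟪(f i).op v, w⟫_ℂ) (le_principal_iff.mpr hb)
    exact ⟨z, mem_closedBall_zero_iff.mp hz, hzU⟩
  choose ℓ hℓ hℓU using hlim
  -- Uniqueness of limits makes the limit sesquilinear; the uniform bound makes it bounded, hence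
  -- represented by an operator.
  let L : H →L⋆[ℂ] H →L[ℂ] ℂ := LinearMap.mkContinuous₂
    (LinearMap.mk₂'ₛₗ (starRingEnd ℂ) (RingHom.id ℂ) ℓ
      (fun v v' w => tendsto_nhds_unique (hℓU _ _) <| by
        simpa [inner_add_left] using (hℓU v w).add (hℓU v' w))
      (fun r v w => tendsto_nhds_unique (hℓU _ _) <| by
        simpa [inner_smul_left, mul_comm] using (hℓU v w).const_mul (starRingEnd ℂ r))
      (fun v w w' => tendsto_nhds_unique (hℓU _ _) <| by
        simpa [inner_add_right] using (hℓU v w).add (hℓU v w'))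
      (fun r v w => tendsto_nhds_unique (hℓU _ _) <| by
        simpa [inner_smul_right] using (hℓU v w).const_mul r)) c hℓ
  let t : H →L[ℂ] H := InnerProductSpace.continuousLinearMapOfBilin L
  have ht : ∀ v w, Tendsto (fun i => ⟪(f i).op v, w⟫_ℂ) U (𝓝 ⟪t v, w⟫_ℂ) := fun v w => by
    rw [InnerProductSpace.continuousLinearMapOfBilin_apply]
    exact hℓU v w
  refine ⟨Elem.mk t (Elem.mem_of_commute_commutant A fun y hy => ?_), ht⟩
  ext v
  refine ext_inner_right ℂ fun w => ?_
  change ⟪y (t v), w⟫_ℂ = ⟪t (y v), w⟫_ℂ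
  rw [← ContinuousLinearMap.adjoint_inner_right]
  refine tendsto_nhds_unique (ht _ _) ((ht (y v) w).congr fun i => ?_)
  rw [ContinuousLinearMap.adjoint_inner_right]
  exact congrArg (fun T : H →L[ℂ] H => ⟪T v, w⟫_ℂ) (hy (f i))

/-- The quadratic form of the supremum of a directed set of self-adjoint elements is the pointwise
supremum of the quadratic forms. -/
theorem isLUB_form {D : Set A.Elem} (hD : ∀ d ∈ D, IsSelfAdjoint d) (hne : D.Nonempty)
    (hdir : DirectedOn (· ≤ ·) D) {s : A.Elem} (hs : IsLUB D s) (v : H) :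
    IsLUB ((fun d => d.form v) '' D) (s.form v) := by
  refine ⟨?_, fun b hb => ?_⟩
  · rintro _ ⟨d, hd, rfl⟩
    exact Elem.form_mono (hs.1 hd) v
  obtain ⟨d₀, hd₀⟩ := hne
  have : Nonempty D := ⟨⟨d₀, hd₀⟩⟩
  have : IsDirectedOrder D := ⟨directedOn_iff_directed.mp hdir⟩
  -- An ultrafilter finer than the order filter yields a weak limit `t` of `D`. It is an upper bound
  -- of `D`, so `s ≤ t`, while any upper bound of the forms of `D` at `v` also bounds the form of
  -- `t`.
  let U : Ultrafilter D := Ultrafilter.of atTop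
  have hU : (U : Filter D) ≤ atTop := Ultrafilter.of_le _
  have hbd : ∀ᶠ i : D in (U : Filter D), ‖(i : A.Elem)‖ ≤ ‖s - d₀‖ + ‖d₀‖ := by
    filter_upwards [hU (eventually_ge_atTop (⟨d₀, hd₀⟩ : D))] with i hi
    have hi' : d₀ ≤ i := hi
    calc ‖(i : A.Elem)‖ = ‖(i - d₀) + d₀‖ := by rw [sub_add_cancel]
      _ ≤ ‖(i : A.Elem) - d₀‖ + ‖d₀‖ := norm_add_le _ _
      _ ≤ ‖s - d₀‖ + ‖d₀‖ := by
        gcongr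
        exact CStarAlgebra.norm_le_norm_of_nonneg_of_le (sub_nonneg.mpr hi')
          (sub_le_sub_right (hs.1 i.2) _)
  obtain ⟨t, ht⟩ := exists_weak_limit U (fun i : D => (i : A.Elem)) _ hbd
  have htf : ∀ w, Tendsto (fun i : D => (i : A.Elem).form w) U (𝓝 (t.form w)) := fun w =>
    (Complex.continuous_re.tendsto _).comp (ht w w)
  have htsa : IsSelfAdjoint t := by
    refine Elem.ext_apply fun v => ext_inner_right ℂ fun w => ?_
    rw [Elem.inner_op_left, star_star, ← inner_conj_symm]
    refine tendsto_nhds_unique ((Complex.continuous_conj.tendsto _).comp (ht w v))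
      ((ht v w).congr fun i => ?_)
    rw [Function.comp_apply, inner_conj_symm, Elem.inner_op_left, (hD i i.2).star_eq]
  have hst : s ≤ t := by
    refine hs.2 fun d hd => Elem.le_of_form (hD d hd) htsa fun w => ?_
    refine ge_of_tendsto (htf w) ?_
    filter_upwards [hU (eventually_ge_atTop (⟨d, hd⟩ : D))] with i hi
    exact Elem.form_mono (show d ≤ i from hi) w
  exact (Elem.form_mono hst v).trans
    (le_of_tendsto (htf v) (Eventually.of_forall fun i => hb ⟨i, i.2, rfl⟩))

/-- A map is normal if its quadratic forms are quadratic forms of the argument. -/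
theorem scottContinuousOn_of_form {φ : A.Elem →L[ℂ] B.Elem}
    (hsa : ∀ x, IsSelfAdjoint x → IsSelfAdjoint (φ x))
    (h : ∀ w : K, ∃ v : H, ∀ x, (φ x).form w = x.form v) :
    ScottContinuousOn {D : Set A.Elem | ∀ d ∈ D, IsSelfAdjoint d} φ := by
  intro D hD hne hdir s hs
  have hssa : IsSelfAdjoint s := by
    obtain ⟨d, hd⟩ := hne
    rw [← sub_add_cancel s d]
    exact (IsSelfAdjoint.of_nonneg (sub_nonneg.mpr (hs.1 hd))).add (hD d hd)
  refine ⟨?_, fun b hb => ?_⟩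
  · rintro _ ⟨d, hd, rfl⟩
    refine Elem.le_of_form (hsa d (hD d hd)) (hsa s hssa) fun w => ?_
    obtain ⟨v, hv⟩ := h w
    rw [hv, hv]
    exact Elem.form_mono (hs.1 hd) v
  · obtain ⟨d, hd⟩ := hne
    have hbsa : IsSelfAdjoint b := by
      rw [← sub_add_cancel b (φ d)]
      exact (IsSelfAdjoint.of_nonneg (sub_nonneg.mpr (hb ⟨d, hd, rfl⟩))).add (hsa d (hD d hd))
    refine Elem.le_of_form (hsa s hssa) hbsa fun w => ?_
    obtain ⟨v, hv⟩ := h w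
    rw [hv]
    refine (isLUB_form hD ⟨d, hd⟩ hdir hs v).2 ?_
    rintro _ ⟨d', hd', rfl⟩
    change d'.form v ≤ b.form w
    rw [← hv]
    exact Elem.form_mono (hb ⟨d', hd', rfl⟩) w

end Normal

/-! ### Examples of normal completely positive maps -/

section Examples

variable {A : VonNeumannAlgebra H} {B : VonNeumannAlgebra K}

theorem map_nonneg_of_form {φ : A.Elem →L[ℂ] B.Elem} (hstar : ∀ x, φ (star x) = star (φ x))
    (h : ∀ w : K, ∃ v : H, ∀ x, (φ x).form w = x.form v) {x : A.Elem} (hx : 0 ≤ x) :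
    0 ≤ φ x := by
  refine Elem.nonneg_of_form ?_ fun w => ?_
  · rw [IsSelfAdjoint, ← hstar, hx.star_eq]
  · obtain ⟨v, hv⟩ := h w
    rw [hv]
    exact Elem.form_nonneg hx v

theorem IsNCP.of_form {φ : A.Elem →L[ℂ] B.Elem} (hstar : ∀ x, φ (star x) = star (φ x))
    (h : ∀ w : K, ∃ v : H, ∀ x, (φ x).form w = x.form v)
    (hcp : ∀ (k : ℕ) (M : CStarMatrix (Fin k) (Fin k) A.Elem), 0 ≤ M →
      ∀ v, 0 ≤ (matrixForm (M.map φ) v).re) : IsNCP φ where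
  completelyPositive :=
    exists_completelyPositive_of_form (fun _ hx => map_nonneg_of_form hstar h hx) hcp
  normal := scottContinuousOn_of_form
    (fun x hx => by rw [IsSelfAdjoint, ← hstar, hx.star_eq]) h

/-- The map `x ↦ T⋆ x T`, for a bounded operator `T` between the Hilbert spaces, is normal and
completely positive. -/
theorem IsNCP.of_conj {φ : A.Elem →L[ℂ] B.Elem} (T : K →L[ℂ] H)
    (h : ∀ x v w, ⟪v, (φ x).op w⟫_ℂ = ⟪T v, x.op (T w)⟫_ℂ) : IsNCP φ := by
  refine IsNCP.of_form (fun x => Elem.ext_apply fun v => ext_inner_left ℂ fun w => ?_)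
    (fun w => ⟨T w, fun x => ?_⟩) fun k M hM v => ?_
  · rw [h, ← Elem.inner_op_left, ← Elem.inner_op_left, ← inner_conj_symm, ← h, inner_conj_symm]
  · rw [Elem.form, Elem.form, inner_re_symm, h, inner_re_symm]
  · have := matrixForm_nonneg hM (fun i => T (v i))
    simpa only [matrixForm, CStarMatrix.map_apply, h] using this

theorem IsNCP.comp {L : Type u} [NormedAddCommGroup L] [InnerProductSpace ℂ L] [CompleteSpace L]
    {C : VonNeumannAlgebra L} {ψ : B.Elem →L[ℂ] C.Elem} {φ : A.Elem →L[ℂ] B.Elem}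
    (hψ : IsNCP ψ) (hφ : IsNCP φ) : IsNCP (ψ.comp φ) where
  completelyPositive := by
    obtain ⟨φ', hφ'⟩ := hφ.completelyPositive
    obtain ⟨ψ', hψ'⟩ := hψ.completelyPositive
    refine ⟨{ toLinearMap := (ψ.comp φ).toLinearMap, map_cstarMatrix_nonneg' := fun k M hM => ?_ },
      fun _ => rfl⟩
    exact hψ.map_matrix_nonneg (hφ.map_matrix_nonneg hM)
  normal := by
    intro D hD hne hdir s hs
    have h := hψ.normal (d := φ '' D) ?_ (hne.image _) ?_ (hφ.normal hD hne hdir hs)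
    · rwa [← Set.image_comp] at h
    · rintro _ ⟨d, hd, rfl⟩
      exact hφ.isSelfAdjoint (hD d hd)
    · rintro _ ⟨d, hd, rfl⟩ _ ⟨d', hd', rfl⟩
      obtain ⟨z, hz, h1, h2⟩ := hdir d hd d' hd'
      exact ⟨φ z, ⟨z, hz, rfl⟩, hφ.monotone h1, hφ.monotone h2⟩

theorem IsContractiveNCP.comp {L : Type u} [NormedAddCommGroup L] [InnerProductSpace ℂ L]
    [CompleteSpace L] {C : VonNeumannAlgebra L} {ψ : B.Elem →L[ℂ] C.Elem}
    {φ : A.Elem →L[ℂ] B.Elem} (hψ : IsContractiveNCP ψ) (hφ : IsContractiveNCP φ) :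
    IsContractiveNCP (ψ.comp φ) where
  toIsNCP := hψ.toIsNCP.comp hφ.toIsNCP
  norm_le_one := (ψ.opNorm_comp_le φ).trans
    (mul_le_one₀ hψ.norm_le_one (norm_nonneg _) hφ.norm_le_one)

/-- Conjugation `x ↦ s⋆ x s` by an element of a von Neumann algebra. -/
noncomputable def conj (s : A.Elem) : A.Elem →L[ℂ] A.Elem :=
  ContinuousLinearMap.mulLeftRight ℂ A.Elem (star s) s

theorem conj_apply (s x : A.Elem) : conj s x = star s * x * s := rfl

theorem isNCP_conj (s : A.Elem) : IsNCP (conj s) :=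
  IsNCP.of_conj s.op fun x v w => by
    rw [conj_apply, Elem.op_mul_apply, Elem.op_mul_apply, Elem.inner_op_right, star_star]

theorem norm_conj_le (s : A.Elem) : ‖conj s‖ ≤ ‖s‖ * ‖s‖ := by
  refine ContinuousLinearMap.opNorm_le_bound _ (by positivity) fun x => ?_
  rw [conj_apply]
  calc ‖star s * x * s‖ ≤ ‖star s‖ * ‖x‖ * ‖s‖ := norm_mul₃_le
    _ = ‖s‖ * ‖s‖ * ‖x‖ := by rw [norm_star]; ring

theorem op_standardCorner (p : A.Elem) (hp : IsStarProjection p) (x : A.Elem) :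
    (standardCorner p hp x).op = (incl p.op).adjoint ∘L x.op ∘L incl p.op := rfl

theorem op_cornerInclusion (p : A.Elem) (hp : IsStarProjection p)
    (y : (A.cornerAlgebra p hp).Elem) :
    (cornerInclusion p hp y).op = incl p.op ∘L y.op ∘L (incl p.op).adjoint := rfl

theorem isContractiveNCP_standardCorner (p : A.Elem) (hp : IsStarProjection p) :
    IsContractiveNCP (standardCorner p hp) where
  toIsNCP := IsNCP.of_conj (incl p.op) fun x v w => by
    rw [op_standardCorner, ContinuousLinearMap.comp_apply, ContinuousLinearMap.comp_apply,
      ContinuousLinearMap.adjoint_inner_right]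
  norm_le_one := by
    rw [standardCorner]
    exact LinearMap.mkContinuous_norm_le _ zero_le_one _

theorem isContractiveNCP_cornerInclusion (p : A.Elem) (hp : IsStarProjection p) :
    IsContractiveNCP (cornerInclusion p hp) where
  toIsNCP := IsNCP.of_conj (incl p.op).adjoint fun x v w => by
    rw [op_cornerInclusion, ContinuousLinearMap.comp_apply, ContinuousLinearMap.comp_apply,
      ContinuousLinearMap.adjoint_inner_left]
  norm_le_one := by
    rw [cornerInclusion]
    exact LinearMap.mkContinuous_norm_le _ zero_le_one _

theorem cornerInclusion_standardCorner (p : A.Elem) (hp : IsStarProjection p) (x : A.Elem) :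
    cornerInclusion p hp (standardCorner p hp x) = p * x * p :=
  Elem.ext_op (extend_restrict (coe_isStarProjection hp) _)

theorem standardCorner_cornerInclusion (p : A.Elem) (hp : IsStarProjection p)
    (y : (A.cornerAlgebra p hp).Elem) : standardCorner p hp (cornerInclusion p hp y) = y :=
  Elem.ext_op (restrict_extend _ _)

theorem cornerInclusion_one (p : A.Elem) (hp : IsStarProjection p) :
    cornerInclusion p hp 1 = p :=
  Elem.ext_op <| by
    ext v
    exact incl_adjoint_incl (coe_isStarProjection hp) v

theorem standardCorner_one (p : A.Elem) (hp : IsStarProjection p) :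
    standardCorner p hp 1 = 1 := by
  rw [← standardCorner_cornerInclusion p hp 1, cornerInclusion_one]
  refine Elem.ext_apply fun v => ?_
  change (incl p.op).adjoint ((1 : A.Elem).op (incl p.op v)) =
    (incl p.op).adjoint (p.op (incl p.op v))
  rw [apply_incl]
  rfl

theorem mul_cornerInclusion_mul (p : A.Elem) (hp : IsStarProjection p)
    (y : (A.cornerAlgebra p hp).Elem) :
    p * cornerInclusion p hp y * p = cornerInclusion p hp y := by
  rw [← cornerInclusion_standardCorner p hp, standardCorner_cornerInclusion]

/-- The map `x ↦ ⟨v, x v⟩ y`. -/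
noncomputable def vectorStateSMul (A : VonNeumannAlgebra H) (v : H) (y : B.Elem) :
    A.Elem →L[ℂ] B.Elem :=
  LinearMap.mkContinuous
    { toFun := fun x => ⟪v, x.op v⟫_ℂ • y
      map_add' := fun x x' => by
        rw [Elem.op_add, add_apply, inner_add_right, add_smul]
      map_smul' := fun r x => by
        rw [Elem.op_smul, smul_apply, inner_smul_right, mul_smul, RingHom.id_apply] }
    (‖v‖ * ‖v‖ * ‖y‖) fun x => by
      change ‖⟪v, x.op v⟫_ℂ • y‖ ≤ _
      rw [norm_smul]
      calc ‖⟪v, x.op v⟫_ℂ‖ * ‖y‖ ≤ ‖v‖ * (‖x‖ * ‖v‖) * ‖y‖ := by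
            gcongr
            refine (norm_inner_le_norm _ _).trans ?_
            gcongr
            exact x.op.le_opNorm v
        _ = ‖v‖ * ‖v‖ * ‖y‖ * ‖x‖ := by ring

theorem vectorStateSMul_apply (v : H) (y : B.Elem) (x : A.Elem) :
    vectorStateSMul A v y x = ⟪v, x.op v⟫_ℂ • y := rfl

theorem re_sum_sum_inner_nonneg {ι E : Type*} [Fintype ι] [NormedAddCommGroup E]
    [InnerProductSpace ℂ E] (u : ι → E) : 0 ≤ (∑ i, ∑ j, ⟪u i, u j⟫_ℂ).re := by
  have h : ∑ i, ∑ j, ⟪u i, u j⟫_ℂ = ⟪∑ i, u i, ∑ i, u i⟫_ℂ := by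
    simp only [sum_inner, inner_sum]
    exact Finset.sum_comm
  rw [h]
  exact inner_self_nonneg (𝕜 := ℂ)

/-- Complete positivity is a Gram matrix argument: with `M = N⋆N` and `y = s⋆s`, the matrix form is
a sum over `l` of the squared norms of `∑ i, N l i v ⊗ s (w i)`. These maps serve to separate
effects under a compression. -/
theorem isContractiveNCP_vectorStateSMul {v : H} (hv : ‖v‖ = 1) {y : B.Elem} (hy0 : 0 ≤ y)
    (hy1 : y ≤ 1) : IsContractiveNCP (vectorStateSMul A v y) where
  norm_le_one := (LinearMap.mkContinuous_norm_le _ (by positivity) _).trans <| by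
    rw [hv, one_mul, one_mul]
    exact (CStarAlgebra.norm_le_one_iff_of_nonneg y).mpr hy1
  toIsNCP := by
    obtain ⟨s, hs⟩ := CStarAlgebra.nonneg_iff_eq_star_mul_self.mp hy0
    refine IsNCP.of_form (fun x => ?_) (fun w => ?_) fun k M hM w => ?_
    · rw [vectorStateSMul_apply, vectorStateSMul_apply, star_smul, hy0.star_eq,
        ← Elem.inner_op_left, ← inner_conj_symm]
      rfl
    · refine ⟨(‖s.op w‖ : ℂ) • v, fun x => ?_⟩
      have h1 : ⟪y.op w, w⟫_ℂ = ((‖s.op w‖ ^ 2 : ℝ) : ℂ) := by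
        rw [hs, Elem.op_mul_apply, Elem.inner_op_left, star_star, inner_self_eq_norm_sq_to_K]
        norm_cast
      rw [vectorStateSMul_apply, Elem.form, Elem.form, Elem.op_smul, smul_apply,
        inner_smul_left, h1, map_smul, inner_smul_left, inner_smul_right, inner_conj_symm,
        Complex.conj_ofReal]
      congr 1
      push_cast
      ring
    · obtain ⟨N, rfl⟩ := exists_eq_star_mul_self_of_nonneg hM
      have h1 : ∀ i j, ⟪w i, (vectorStateSMul A v y ((star N * N) i j)).op (w j)⟫_ℂ =
          ∑ l, ⟪(N l i).op v ⊗ₜ[ℂ] s.op (w i), (N l j).op v ⊗ₜ[ℂ] s.op (w j)⟫_ℂ := by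
        intro i j
        rw [vectorStateSMul_apply, Elem.op_smul, smul_apply, inner_smul_right, hs,
          Elem.op_mul_apply, Elem.inner_op_right (star s), star_star, CStarMatrix.mul_apply,
          op_sum_apply, inner_sum, Finset.sum_mul]
        refine Finset.sum_congr rfl fun l _ => ?_
        rw [TensorProduct.inner_tmul, CStarMatrix.star_apply, Elem.op_mul_apply,
          Elem.inner_op_right, star_star]
      simp only [matrixForm, CStarMatrix.map_apply, h1]
      rw [Finset.sum_congr rfl fun i _ => Finset.sum_comm, Finset.sum_comm, Complex.re_sum]
      exact Finset.sum_nonneg fun l _ =>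
        re_sum_sum_inner_nonneg fun i => (N l i).op v ⊗ₜ[ℂ] s.op (w i)

end Examples

/-! ### Polar decomposition -/

section Polar

variable {A : VonNeumannAlgebra H}

/-- The polar decomposition of a bounded operator `r`, for an operator `a` with
`‖a v‖ = ‖r v‖` for all `v`. -/
theorem exists_partial_isometry (r a : H →L[ℂ] H) (h : ∀ v, ‖a v‖ = ‖r v‖) :
    ∃ u : H →L[ℂ] H, u * a = r ∧ IsStarProjection (star u * u) ∧ u * (star u * u) = u ∧
      star u * u * a = a ∧ ∀ w, (star u * u) w ∈ closure (Set.range a) := by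
  let V : Submodule ℂ H := (LinearMap.range a.toLinearMap).topologicalClosure
  have hVc : IsClosed (V : Set H) := Submodule.isClosed_topologicalClosure _
  have : CompleteSpace V := hVc.completeSpace_coe
  have hVr : (V : Set H) = closure (Set.range a) := by
    rw [Submodule.topologicalClosure_coe]
    rfl
  have haV : ∀ v, a v ∈ V := fun v =>
    Submodule.le_topologicalClosure _ (LinearMap.mem_range_self a.toLinearMap v)
  let e : H →ₗ[ℂ] V := a.toLinearMap.codRestrict V haV
  have he : DenseRange e := by
    intro z
    rw [closure_subtype]
    have hz : (z : H) ∈ closure (Set.range a) := hVr ▸ z.2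
    convert hz using 2
    ext y
    constructor
    · rintro ⟨_, ⟨x, rfl⟩, rfl⟩
      exact ⟨x, rfl⟩
    · rintro ⟨x, rfl⟩
      exact ⟨e x, ⟨x, rfl⟩, rfl⟩
  -- Equality of norms makes `a v ↦ r v` well defined and isometric on the range of `a`; it extends
  -- to the closure `V`, and `u` is made zero on the orthogonal complement.
  have hbd : ∀ v, ‖r.toLinearMap v‖ ≤ 1 * ‖e v‖ := fun v => by
    rw [one_mul]
    exact (h v).ge
  let u₀ : V →L[ℂ] H := r.toLinearMap.extendOfNorm e
  have hu₀ : ∀ v, u₀ (e v) = r v := LinearMap.extendOfNorm_eq he ⟨1, hbd⟩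
  have hiso : ∀ z, ‖u₀ z‖ = ‖z‖ := fun z =>
    he.induction (P := fun z => ‖u₀ z‖ = ‖z‖)
      (by
        rintro _ ⟨x, rfl⟩
        rw [hu₀]
        exact (h x).symm)
      (isClosed_eq (by fun_prop) (by fun_prop)) z
  let u : H →L[ℂ] H := u₀ ∘L V.orthogonalProjectionOnto
  have hm : star u * u = V.starProjection := by
    have h1 : u₀.adjoint ∘L u₀ = 1 :=
      (ContinuousLinearMap.norm_map_iff_adjoint_comp_self _).mp hiso
    ext v
    change (u₀ ∘L V.orthogonalProjectionOnto).adjoint (u₀ (V.orthogonalProjectionOnto v)) = _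
    rw [ContinuousLinearMap.adjoint_comp, ContinuousLinearMap.comp_apply,
      show u₀.adjoint (u₀ (V.orthogonalProjectionOnto v)) = V.orthogonalProjectionOnto v from
        congrArg (fun T : V →L[ℂ] V => T _) h1,
      Submodule.adjoint_orthogonalProjectionOnto]
    rfl
  refine ⟨u, ?_, ?_, ?_, ?_, fun w => ?_⟩
  · ext v
    change u₀ (V.orthogonalProjectionOnto (a v)) = r v
    rw [← hu₀ v]
    congr 1
    exact Submodule.orthogonalProjectionOnto_mem_subspace_eq_self (e v)
  · rw [hm]
    exact isStarProjection_starProjection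
  · rw [hm]
    ext v
    change u₀ (V.orthogonalProjectionOnto (V.starProjection v)) =
      u₀ (V.orthogonalProjectionOnto v)
    congr 1
    exact Submodule.orthogonalProjectionOnto_mem_subspace_eq_self _
  · rw [hm]
    ext v
    exact Submodule.starProjection_eq_self_iff.mpr (haV v)
  · rw [hm, ← hVr]
    exact V.starProjection_apply_mem w

theorem mul_eq_zero_of_range_subset_closure {E : Type*} [NormedAddCommGroup E]
    [NormedSpace ℂ E] {a m z : E →L[ℂ] E}
    (hm : ∀ w, m w ∈ closure (Set.range a)) (hz : z * a = 0) : z * m = 0 := by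
  ext w
  have h1 : closure (Set.range a) ⊆ {v | z v = 0} := by
    refine closure_minimal ?_ (isClosed_eq (by fun_prop) continuous_const)
    rintro _ ⟨v, rfl⟩
    exact congrArg (fun T : E →L[ℂ] E => T v) hz
  exact h1 (hm w)

/-- The polar decomposition in a von Neumann algebra. -/
theorem exists_polar (r : A.Elem) : ∃ u : A.Elem, u * CFC.sqrt (star r * r) = r ∧
    IsStarProjection (star u * u) ∧ u * (star u * u) = u ∧
    star u * u * CFC.sqrt (star r * r) = CFC.sqrt (star r * r) ∧
    ∀ w, (star u * u).op w ∈ closure (Set.range (CFC.sqrt (star r * r)).op) := by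
  set a := CFC.sqrt (star r * r) with ha
  have ha0 : 0 ≤ a := CFC.sqrt_nonneg _
  have haa : star a * a = star r * r := by
    rw [ha0.star_eq, ha, CFC.sqrt_mul_sqrt_self _ (star_mul_self_nonneg r)]
  have hnorm : ∀ v, ‖a.op v‖ = ‖r.op v‖ := fun v => by
    rw [← sq_eq_sq₀ (norm_nonneg _) (norm_nonneg _), ← Elem.form_star_mul_self,
      ← Elem.form_star_mul_self, haa]
  obtain ⟨u, hua, hproj, hum, hma, hcl⟩ := exists_partial_isometry r.op a.op hnorm
  set m := star u * u with hm
  have hu : u ∈ A := by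
    -- For `y` in the commutant, `yu` and `uy` agree on the range of `a`, hence on that of `m`. Both
    -- vanish on the range of `1 - m`: since `y⋆` preserves the range of `m`, `y` preserves its
    -- kernel.
    refine Elem.mem_of_commute_commutant A fun y hy => ?_
    have h1 : (y * u - u * y) * m = 0 := by
      refine mul_eq_zero_of_range_subset_closure hcl ?_
      rw [sub_mul, mul_assoc, hua, mul_assoc, ← hy a, ← mul_assoc, hua, hy r, sub_self]
    have h2 : (1 - m) * star y * m = 0 := by
      refine mul_eq_zero_of_range_subset_closure hcl ?_
      rw [mul_assoc, ← Elem.commute_star_commutant hy a, ← mul_assoc, sub_mul, hma, one_mul,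
        sub_self, zero_mul]
    have h3 : m * y * (1 - m) = 0 := by
      have := congrArg star h2
      rwa [star_mul, hproj.isSelfAdjoint.star_eq, star_mul, star_star, star_sub, star_one,
        hproj.isSelfAdjoint.star_eq, star_zero, ← mul_assoc] at this
    have h4 : u * y * (1 - m) = 0 := by
      rw [← hum, mul_assoc u, mul_assoc u, h3, mul_zero]
    have h5 : y * u * m = u * y * m := by
      rw [← sub_eq_zero, ← sub_mul]
      exact h1
    rw [mul_sub, mul_one, sub_eq_zero] at h4
    rw [h4, ← h5, mul_assoc, hum]
  refine ⟨Elem.mk u hu, Elem.ext_op hua, ⟨Elem.ext_op hproj.isIdempotentElem.eq,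
    Elem.ext_op hproj.isSelfAdjoint.star_eq⟩, Elem.ext_op hum, Elem.ext_op hma, hcl⟩

theorem Elem.mul_eq_zero_of_range_subset_closure {a m z : A.Elem}
    (hm : ∀ w, m.op w ∈ closure (Set.range a.op)) (hz : z * a = 0) : z * m = 0 :=
  Elem.ext_op (VonNeumannAlgebra.mul_eq_zero_of_range_subset_closure hm (congrArg Elem.op hz))

/-- The range projection of a positive element. -/
theorem exists_range_projection {a : A.Elem} (ha : 0 ≤ a) : ∃ m : A.Elem, IsStarProjection m ∧
    m * a = a ∧ ∀ w, m.op w ∈ closure (Set.range a.op) := by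
  obtain ⟨u, -, h1, -, h2, h3⟩ := exists_polar a
  rw [ha.star_eq, CFC.sqrt_mul_self a ha] at h2 h3
  exact ⟨_, h1, h2, h3⟩

theorem cfc_min_one_nonneg {x : A.Elem} (hx : 0 ≤ x) (n : ℕ) :
    0 ≤ cfc (fun t : ℝ => min 1 (n * t)) x :=
  cfc_nonneg fun _ ht =>
    le_min zero_le_one (mul_nonneg (Nat.cast_nonneg n) (spectrum_nonneg_of_nonneg hx ht))

theorem cfc_min_one_le_smul {x : A.Elem} (hx : 0 ≤ x) (n : ℕ) :
    cfc (fun t : ℝ => min 1 (n * t)) x ≤ (n : ℝ) • x := by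
  have h1 : cfc (fun t : ℝ => (n : ℝ) * t) x = (n : ℝ) • x := cfc_const_mul_id _ _
  rw [← h1]
  exact cfc_mono fun t _ => min_le_right _ _

theorem monotone_cfc_min_one {x : A.Elem} (hx : 0 ≤ x) :
    Monotone fun n : ℕ => cfc (fun t : ℝ => min 1 (n * t)) x := fun n k hnk =>
  cfc_mono fun t ht => by
    have ht0 := spectrum_nonneg_of_nonneg hx ht
    gcongr

/-- The range projection of a positive element `x` is the supremum of the elements
`min 1 (n x)`. -/
theorem isLUB_range_projection {x m : A.Elem} (hx : 0 ≤ x) (hm : IsStarProjection m)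
    (hmx : m * x = x) (hcl : ∀ w, m.op w ∈ closure (Set.range x.op)) :
    IsLUB (Set.range fun n : ℕ => cfc (fun t : ℝ => min 1 (n * t)) x) m := by
  have hspec : ∀ t ∈ spectrum ℝ x, 0 ≤ t := fun t ht => spectrum_nonneg_of_nonneg hx ht
  set f : ℕ → A.Elem := fun n => cfc (fun t : ℝ => min 1 (n * t)) x with hf
  have hf0 : ∀ n, 0 ≤ f n := cfc_min_one_nonneg hx
  have hf1 : ∀ n, f n ≤ 1 := fun n => cfc_le_one _ _ fun t _ => min_le_left _ _
  have hfx : ∀ n : ℕ, f n ≤ (n : ℝ) • x := cfc_min_one_le_smul hx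
  -- `f n ≤ n x` and `(1 - m) x = 0` give `(1 - m) f n (1 - m) = 0`; writing `f n` as a square gives
  -- `f n (1 - m) = 0`.
  have hmf' : ∀ n, m * f n = f n := fun n => by
    have h1 : (1 - m) * f n * (1 - m) = 0 := by
      refine le_antisymm ?_ (hm.one_sub.isSelfAdjoint.conjugate_nonneg (hf0 n))
      have h2 := hm.one_sub.isSelfAdjoint.conjugate_le_conjugate (hfx n)
      rwa [mul_smul_comm, sub_mul 1 m x, hmx, one_mul, sub_self, smul_zero, zero_mul] at h2
    have h2 : f n * (1 - m) = 0 := by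
      obtain ⟨y, hy⟩ := exists_eq_star_mul_self_of_nonneg (hf0 n)
      have h3 : star (y * (1 - m)) * (y * (1 - m)) = 0 := by
        rw [star_mul, hm.one_sub.isSelfAdjoint.star_eq, ← h1, hy]
        simp only [mul_assoc]
      rw [hy, mul_assoc, eq_zero_of_star_mul_self_eq_zero h3, mul_zero]
    rw [mul_sub, mul_one, sub_eq_zero] at h2
    have h4 := congrArg star h2
    rw [star_mul, (hf0 n).star_eq, hm.isSelfAdjoint.star_eq] at h4
    exact h4.symm
  have hmf : ∀ n, m * f n * m = f n := fun n => by
    have h4 := congrArg star (hmf' n)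
    rw [star_mul, (hf0 n).star_eq, hm.isSelfAdjoint.star_eq] at h4
    rw [hmf', h4]
  -- On the spectrum, `min 1 (n t) * t - t` is zero unless `n t < 1`, in which case its absolute
  -- value is at most `t ≤ 1/n`.
  have hfl : Filter.Tendsto (fun n => f n * x) Filter.atTop (nhds x) := by
    rw [tendsto_iff_norm_sub_tendsto_zero]
    refine squeeze_zero' (Filter.Eventually.of_forall fun _ => norm_nonneg _) ?_
      tendsto_one_div_atTop_nhds_zero_nat
    filter_upwards [Filter.eventually_gt_atTop 0] with n hn
    have hn' : (0 : ℝ) < n := Nat.cast_pos.mpr hn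
    have h1 : f n * x - x = cfc (fun t : ℝ => min 1 (n * t) * t - t) x := by
      rw [cfc_sub _ _ x, cfc_mul _ _ x, cfc_id' ℝ x]
    rw [h1]
    refine norm_cfc_le (by positivity) fun t ht => ?_
    have ht0 := hspec t ht
    rcases min_cases 1 (n * t) with ⟨h, h'⟩ | ⟨h, h'⟩
    · rw [h, one_mul, sub_self, norm_zero]
      positivity
    · have h2 : t ≤ 1 / n := (le_div_iff₀ hn').mpr (by linarith)
      rw [h, Real.norm_eq_abs, abs_le]
      have h3 : n * t * t ≤ 1 * t := by gcongr
      have h4 : 0 ≤ n * t * t := by positivity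
      constructor <;> linarith
  refine ⟨?_, fun y hy => ?_⟩
  · rintro _ ⟨n, rfl⟩
    have h := hm.isSelfAdjoint.conjugate_le_conjugate (hf1 n)
    rw [hmf n, mul_one, hm.isIdempotentElem.eq] at h
    exact h
  · have hfy : ∀ n, f n ≤ y := fun n => hy ⟨n, rfl⟩
    have hy0 : 0 ≤ y := (hf0 0).trans (hfy 0)
    refine Elem.le_of_form hm.isSelfAdjoint (.of_nonneg hy0) fun w => ?_
    rw [← sub_nonneg, ← Elem.form_sub]
    -- Split `w` into `m w` and a part `k` killed by `m`. The inequality is proved at `z + k` for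
    -- `z` in the range of `x`, where `f n` converges, and passes by continuity to `z = m w`.
    set k := w - m.op w with hk
    have hmk : m.op k = 0 := by
      rw [hk, map_sub, ← Elem.op_mul_apply, hm.isIdempotentElem.eq, sub_self]
    have hcont : Continuous fun z => (y - m).form (z + k) := by
      unfold Elem.form
      fun_prop
    have hsub : closure (Set.range x.op) ⊆ {z | 0 ≤ (y - m).form (z + k)} := by
      refine closure_minimal ?_ (isClosed_le continuous_const hcont)
      rintro _ ⟨v, rfl⟩
      have hmz : m.op (x.op v + k) = x.op v := by
        rw [map_add, hmk, add_zero, ← Elem.op_mul_apply, hmx]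
      have hfz : ∀ n, (f n).op (x.op v + k) = (f n * x).op v := fun n => by
        conv_lhs => rw [← hmf n]
        rw [Elem.op_mul_apply, hmz, ← Elem.op_mul_apply]
        rw [hmf']
      change 0 ≤ (y - m).form (x.op v + k)
      rw [Elem.form_sub, sub_nonneg, Elem.form, hmz]
      have hlim : Filter.Tendsto (fun n => (f n).form (x.op v + k)) Filter.atTop
          (nhds (re ⟪x.op v, x.op v + k⟫_ℂ)) := by
        have hop : Filter.Tendsto (fun n => (f n * x).op v) Filter.atTop (nhds (x.op v)) := by
          rw [tendsto_iff_norm_sub_tendsto_zero] at hfl ⊢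
          refine squeeze_zero (fun _ => norm_nonneg _) (fun n => ?_)
            (by simpa using hfl.mul_const ‖v‖)
          exact (f n * x - x).op.le_opNorm v
        simp only [Elem.form, hfz]
        exact (RCLike.continuous_re.tendsto _).comp (hop.inner tendsto_const_nhds)
      exact le_of_tendsto' hlim fun n => Elem.form_mono (hfy n) _
    have := hsub (hcl w)
    rwa [Set.mem_ofPred_eq, hk, add_sub_cancel] at this

end Polar

/-! ### Elements annihilated by a normal completely positive map -/

section Kernel

variable {A : VonNeumannAlgebra H} {B : VonNeumannAlgebra K}

theorem IsContractiveNCP.map_one_le {φ : A.Elem →L[ℂ] B.Elem} (hφ : IsContractiveNCP φ) :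
    φ 1 ≤ 1 := by
  rw [← CStarAlgebra.norm_le_one_iff_of_nonneg (φ 1) (hφ.map_nonneg zero_le_one)]
  calc ‖φ 1‖ ≤ ‖φ‖ * ‖(1 : A.Elem)‖ := φ.le_opNorm 1
    _ ≤ 1 * 1 := by
      gcongr
      · exact hφ.norm_le_one
      · exact (CStarAlgebra.norm_le_one_iff_of_nonneg (1 : A.Elem) zero_le_one).mpr le_rfl
    _ = 1 := one_mul 1

/-- This is where normality enters: `m` is the supremum of the elements `min 1 (n x)`, whose images
are at most `n φ(x) = 0`. -/
theorem IsNCP.map_range_projection_eq_zero {φ : A.Elem →L[ℂ] B.Elem} (hφ : IsNCP φ) {x m : A.Elem}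
    (hx : 0 ≤ x) (hm : IsStarProjection m) (hmx : m * x = x)
    (hcl : ∀ w, m.op w ∈ closure (Set.range x.op)) (h0 : φ x = 0) : φ m = 0 := by
  refine le_antisymm ?_ (hφ.map_nonneg hm.nonneg)
  refine (hφ.normal ?_ (Set.range_nonempty _) ?_ (isLUB_range_projection hx hm hmx hcl)).2 ?_
  · rintro _ ⟨n, rfl⟩
    exact .of_nonneg (cfc_min_one_nonneg hx n)
  · exact directedOn_range.mpr (monotone_cfc_min_one hx).directed_le
  · rintro _ ⟨_, ⟨n, rfl⟩, rfl⟩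
    refine (hφ.monotone (cfc_min_one_le_smul hx n)).trans ?_
    rw [← Complex.coe_smul, map_smul, h0, smul_zero]

/-- By Kadison-Schwarz, since `(xq)⋆(xq) ≤ ‖x‖² q`. -/
theorem IsContractiveNCP.map_mul_eq_zero {φ : A.Elem →L[ℂ] B.Elem} (hφ : IsContractiveNCP φ)
    {q : A.Elem} (hq : IsStarProjection q) (h0 : φ q = 0) (x : A.Elem) : φ (x * q) = 0 := by
  refine eq_zero_of_star_mul_self_eq_zero (le_antisymm ?_ (star_mul_self_nonneg _))
  refine (hφ.star_map_mul_map_le hφ.map_one_le _).trans ?_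
  have h1 : star (x * q) * (x * q) ≤ (‖x‖ ^ 2) • q := by
    have h2 := hq.isSelfAdjoint.conjugate_le_conjugate
      (CStarAlgebra.star_mul_le_algebraMap_norm_sq (a := x))
    rw [Algebra.algebraMap_eq_smul_one, mul_smul_comm, smul_mul_assoc, mul_one,
      hq.isIdempotentElem.eq] at h2
    rwa [star_mul, hq.isSelfAdjoint.star_eq, mul_assoc, ← mul_assoc (star x), ← mul_assoc]
  refine (hφ.monotone h1).trans ?_
  rw [← Complex.coe_smul, map_smul, h0, smul_zero]

theorem IsContractiveNCP.map_compress {φ : A.Elem →L[ℂ] B.Elem} (hφ : IsContractiveNCP φ)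
    {p : A.Elem} (hp : IsStarProjection p) (h : φ (1 - p) = 0) (x : A.Elem) :
    φ (p * x * p) = φ x := by
  have h1 : ∀ y, φ (y * (1 - p)) = 0 := hφ.map_mul_eq_zero hp.one_sub h
  have h2 : ∀ y, φ ((1 - p) * y) = 0 := fun y => by
    have := h1 (star y)
    rw [← hp.one_sub.isSelfAdjoint.star_eq, ← star_mul, hφ.map_star, star_eq_zero] at this
    exact this
  have h3 : x = p * x * p + (p * x * (1 - p) + (1 - p) * x) := by noncomm_ring
  conv_rhs => rw [h3, map_add, map_add, h1, h2, add_zero, add_zero]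

theorem isContractiveNCP_id : IsContractiveNCP (ContinuousLinearMap.id ℂ A.Elem) where
  toIsNCP := IsNCP.of_conj 1 fun _ _ _ => rfl
  norm_le_one := ContinuousLinearMap.norm_id_le

end Kernel

/-! ### Corners -/

section Corner

variable {L : Type u} [NormedAddCommGroup L] [InnerProductSpace ℂ L] [CompleteSpace L]
  {A : VonNeumannAlgebra H} {B : VonNeumannAlgebra K} {C : VonNeumannAlgebra L}

/-- A corner for `a` has a section with values below `a` on effects. -/
theorem IsCornerFor.exists_section {h : A.Elem →L[ℂ] B.Elem} {a : A.Elem} (H : IsCornerFor h a) :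
    ∃ σ : B.Elem →L[ℂ] A.Elem, IsContractiveNCP σ ∧ (∀ y, h (σ y) = y) ∧
      ∀ y, y ≤ 1 → σ y ≤ a := by
  -- With `m` the range projection of `1 - a`, `1 - m` is a projection below `a` on which `a` acts
  -- as the identity, so the standard corner of `1 - m` does not distinguish `a` from `1`.
  have hx : 0 ≤ 1 - a := sub_nonneg.mpr H.le_one
  obtain ⟨m, hm, hmx, hcl⟩ := exists_range_projection hx
  have hxm : 1 - a = m * (1 - a) * m := by
    have := congrArg star hmx
    rw [star_mul, hx.star_eq, hm.isSelfAdjoint.star_eq] at this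
    rw [hmx, this]
  have hxle : 1 - a ≤ m := by
    rw [hxm]
    refine (hm.isSelfAdjoint.conjugate_le_conjugate (sub_le_self 1 H.nonneg)).trans_eq ?_
    rw [mul_one, hm.isIdempotentElem.eq]
  have hp := hm.one_sub
  have hpa : 1 - m ≤ a := sub_le_comm.mp hxle
  have hm0 : h m = 0 := H.isContractiveNCP.map_range_projection_eq_zero hx hm hmx hcl (by
    rw [map_sub, H.map_eq, sub_self])
  have hpap : (1 - m) * a * (1 - m) = 1 - m := by
    have h1 : (1 - m) * (1 - a) = 0 := by rw [sub_mul, one_mul, hmx, sub_self]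
    rw [mul_sub, mul_one, sub_eq_zero] at h1
    rw [← h1, hp.isIdempotentElem.eq]
  have hπ : standardCorner (1 - m) hp a = standardCorner (1 - m) hp 1 := by
    rw [← standardCorner_cornerInclusion (1 - m) hp (standardCorner (1 - m) hp a),
      ← standardCorner_cornerInclusion (1 - m) hp (standardCorner (1 - m) hp 1),
      cornerInclusion_standardCorner, cornerInclusion_standardCorner, hpap, mul_one,
      hp.isIdempotentElem.eq]
  obtain ⟨f', ⟨hf', hf'h⟩, -⟩ := H.universal _ _ (isContractiveNCP_standardCorner (1 - m) hp) hπ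
  have hσ := (isContractiveNCP_cornerInclusion (1 - m) hp).comp hf'
  refine ⟨(cornerInclusion (1 - m) hp).comp f', hσ, fun y => ?_, fun y hy => ?_⟩
  -- Both `h ∘ σ` and the identity factor `h` through `h`; for the former this says `h((1 - m) x (1
  -- - m)) = h x`, which holds because `h m = 0`.
  · have huniq := (H.universal _ h H.isContractiveNCP H.map_eq).unique
      (y₁ := h.comp ((cornerInclusion (1 - m) hp).comp f')) (y₂ := ContinuousLinearMap.id ℂ B.Elem)
      ⟨H.isContractiveNCP.comp hσ, ?_⟩ ⟨isContractiveNCP_id, ContinuousLinearMap.id_comp h⟩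
    · exact congrArg (fun T : B.Elem →L[ℂ] B.Elem => T y) huniq
    · ext x
      have h1 : f' (h x) = standardCorner (1 - m) hp x :=
        congrArg (fun T : A.Elem →L[ℂ] _ => T x) hf'h
      rw [ContinuousLinearMap.comp_apply, ContinuousLinearMap.comp_apply,
        ContinuousLinearMap.comp_apply, h1, cornerInclusion_standardCorner]
      exact H.isContractiveNCP.map_compress hp (by rw [sub_sub_cancel, hm0]) x
  · refine ((hσ.monotone hy).trans ?_).trans hpa
    have h1 := (isContractiveNCP_cornerInclusion (1 - m) hp).monotone hf'.map_one_le
    rwa [cornerInclusion_one] at h1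

theorem IsCornerFor.map_one {h : A.Elem →L[ℂ] B.Elem} {a : A.Elem} (H : IsCornerFor h a) :
    h 1 = 1 := by
  obtain ⟨σ, hσ, hhσ, hσa⟩ := H.exists_section
  refine le_antisymm H.isContractiveNCP.map_one_le ?_
  rw [← hhσ 1]
  exact H.isContractiveNCP.monotone (hσ.map_one_le)

/-- The effect is `σ b`. As `σ b ≤ a ≤ 1`, a map `f` with `f (σ b) = f 1` also has `f a = f 1`, so
it factors as `g ∘ φ`; then `g b = f (σ b) = g 1`, and `g` factors through `ψ`. -/
theorem IsCorner.comp {ψ : B.Elem →L[ℂ] C.Elem} {φ : A.Elem →L[ℂ] B.Elem}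
    (hψ : IsCorner ψ) (hφ : IsCorner φ) : IsCorner (ψ.comp φ) := by
  obtain ⟨a, ha⟩ := hφ
  obtain ⟨b, hb⟩ := hψ
  obtain ⟨σ, hσ, hφσ, hσa⟩ := ha.exists_section
  have hca : σ b ≤ a := hσa b hb.le_one
  refine ⟨σ b, ⟨hb.isContractiveNCP.comp ha.isContractiveNCP, hσ.map_nonneg hb.nonneg,
    hca.trans ha.le_one, ?_, fun D f hf hfc => ?_⟩⟩
  · rw [ContinuousLinearMap.comp_apply, ContinuousLinearMap.comp_apply, hφσ, ha.map_one, hb.map_eq]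
  · have hfa : f a = f 1 := le_antisymm (hf.monotone ha.le_one) (hfc ▸ hf.monotone hca)
    obtain ⟨g, ⟨hg, hgφ⟩, hguniq⟩ := ha.universal D f hf hfa
    have hgφ' : ∀ x, g (φ x) = f x := fun x => congrArg (fun T : A.Elem →L[ℂ] _ => T x) hgφ
    have hgb : g b = g 1 := by
      rw [← hφσ b, hgφ', hfc, ← hgφ', ha.map_one]
    obtain ⟨k, ⟨hk, hkψ⟩, hkuniq⟩ := hb.universal D g hg hgb
    refine ⟨k, ⟨hk, ?_⟩, fun k' hk' => hkuniq k' ⟨hk'.1, ?_⟩⟩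
    · rw [← ContinuousLinearMap.comp_assoc, hkψ, hgφ]
    · exact hguniq _ ⟨hk'.1.comp hb.isContractiveNCP, by
        rw [ContinuousLinearMap.comp_assoc, hk'.2]⟩

end Corner

/-! ### Compressions -/

section Compression

variable {L : Type u} [NormedAddCommGroup L] [InnerProductSpace ℂ L] [CompleteSpace L]
  {A : VonNeumannAlgebra H} {B : VonNeumannAlgebra K} {C : VonNeumannAlgebra L}

/-- Write `e = s⋆s`, factor conjugation by `s` through `c`, and evaluate the factor at `1`. -/
theorem IsCompressionFor.exists_effect {c : B.Elem →L[ℂ] A.Elem} {a : A.Elem}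
    (H : IsCompressionFor c a) {e : A.Elem} (he0 : 0 ≤ e) (hea : e ≤ a) :
    ∃ y, 0 ≤ y ∧ y ≤ 1 ∧ c y = e := by
  obtain ⟨s, hs⟩ := CStarAlgebra.nonneg_iff_eq_star_mul_self.mp he0
  have hg1 : conj s 1 = e := by rw [conj_apply, mul_one, ← hs]
  have hg : IsContractiveNCP (conj s) := ⟨isNCP_conj s, (norm_conj_le s).trans <| by
    rw [← CStarRing.norm_star_mul_self, ← hs]
    exact (CStarAlgebra.norm_le_one_iff_of_nonneg e).mpr (hea.trans H.le_one)⟩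
  obtain ⟨g, ⟨hg', hcg⟩, -⟩ := H.universal A (conj s) hg (hg1.trans_le hea)
  refine ⟨g 1, hg'.map_nonneg zero_le_one, hg'.map_one_le, ?_⟩
  rw [← hg1, ← hcg]
  rfl

/-- For a unit vector `v`, the maps `z ↦ ⟨v, z v⟩ x` and `z ↦ ⟨v, z v⟩ y` agree after `c`, so
uniqueness of factorisations makes them equal; evaluate at `1`. -/
theorem IsCompressionFor.effect_ext {c : B.Elem →L[ℂ] A.Elem} {a : A.Elem}
    (H : IsCompressionFor c a) {x y : B.Elem} (hx0 : 0 ≤ x) (hx1 : x ≤ 1) (hy0 : 0 ≤ y)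
    (hy1 : y ≤ 1) (hxy : c x = c y) : x = y := by
  rcases subsingleton_or_nontrivial K with hK | hK
  · exact Elem.ext_apply fun v => Subsingleton.elim _ _
  obtain ⟨v, hv⟩ := exists_norm_eq K zero_le_one
  have h1 := isContractiveNCP_vectorStateSMul (A := B) hv hx0 hx1
  have h2 := isContractiveNCP_vectorStateSMul (A := B) hv hy0 hy1
  have h3 : c.comp (vectorStateSMul B v x) = c.comp (vectorStateSMul B v y) := by
    ext z
    rw [ContinuousLinearMap.comp_apply, ContinuousLinearMap.comp_apply, vectorStateSMul_apply,
      vectorStateSMul_apply, map_smul, map_smul, hxy]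
  have hc := H.isContractiveNCP.comp h1
  have h4 := (H.universal B _ hc (H.map_one ▸ H.isContractiveNCP.monotone h1.map_one_le)).unique
    ⟨h1, rfl⟩ ⟨h2, h3.symm⟩
  have h5 := congrArg (fun T : B.Elem →L[ℂ] B.Elem => T 1) h4
  have h6 : ⟪v, (1 : B.Elem).op v⟫_ℂ = 1 := by
    rw [Elem.op_one, one_apply_eq_self, inner_self_eq_norm_sq_to_K, hv]
    norm_num
  simpa [vectorStateSMul_apply, h6] using h5

theorem IsCompressionFor.eq_of_isSelfAdjoint {c : B.Elem →L[ℂ] A.Elem} {a : A.Elem}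
    (H : IsCompressionFor c a) {x : B.Elem} (hx : IsSelfAdjoint x) (hcx : c x = 0) : x = 0 := by
  obtain ⟨r, hr0, hr⟩ : ∃ r : ℝ, 0 < r ∧ ∀ y : B.Elem, ‖y‖ ≤ ‖x⁺‖ + ‖x⁻‖ → ‖(r : ℂ) • y‖ ≤ 1 := by
    -- This factor scales both `x⁺` and `x⁻` down to effects; the `+ 1` keeps it positive when `x =
    -- 0`.
    refine ⟨(‖x⁺‖ + ‖x⁻‖ + 1)⁻¹, by positivity, fun y hy => ?_⟩
    rw [norm_smul, Complex.norm_real, Real.norm_of_nonneg (by positivity),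
      inv_mul_le_iff₀ (by positivity)]
    linarith
  have heff : ∀ y : B.Elem, 0 ≤ y → ‖y‖ ≤ ‖x⁺‖ + ‖x⁻‖ → 0 ≤ (r : ℂ) • y ∧ (r : ℂ) • y ≤ 1 := by
    intro y hy hyn
    have h0 : 0 ≤ (r : ℂ) • y := by
      rw [Complex.coe_smul]
      exact smul_nonneg hr0.le hy
    exact ⟨h0, (CStarAlgebra.norm_le_one_iff_of_nonneg _).mp (hr y hyn)⟩
  obtain ⟨hp0, hp1⟩ := heff x⁺ (CFC.posPart_nonneg x) (by linarith [norm_nonneg x⁻])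
  obtain ⟨hn0, hn1⟩ := heff x⁻ (CFC.negPart_nonneg x) (by linarith [norm_nonneg x⁺])
  have hsub := CFC.posPart_sub_negPart x hx
  have h := H.effect_ext hp0 hp1 hn0 hn1 (by
    rw [← sub_eq_zero, ← map_sub, ← smul_sub, hsub, map_smul, hcx, smul_zero])
  rw [← sub_eq_zero, ← smul_sub, hsub, smul_eq_zero] at h
  exact h.resolve_left (by exact_mod_cast hr0.ne')

/-- The difference `c y - c x` is a positive element below `a`, hence equals `c z` for an effect
`z`, and injectivity on self-adjoint elements gives `y - x = z`. -/
theorem IsCompressionFor.le_of_map_le {c : B.Elem →L[ℂ] A.Elem} {a : A.Elem}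
    (H : IsCompressionFor c a) {x y : B.Elem} (hx0 : 0 ≤ x) (hy0 : 0 ≤ y)
    (hy1 : y ≤ 1) (hxy : c x ≤ c y) : x ≤ y := by
  have hc := H.isContractiveNCP
  have h1 : c y - c x ≤ a := by
    rw [← H.map_one]
    exact (sub_le_self _ (hc.map_nonneg hx0)).trans (hc.monotone hy1)
  obtain ⟨z, hz0, -, hz⟩ := H.exists_effect (sub_nonneg.mpr hxy) h1
  have h2 : y - x - z = 0 := H.eq_of_isSelfAdjoint
    (((IsSelfAdjoint.of_nonneg hy0).sub (.of_nonneg hx0)).sub (.of_nonneg hz0)) (by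
      rw [map_sub, map_sub, hz, sub_self])
  rw [← sub_nonneg, sub_eq_zero.mp h2]
  exact hz0

theorem IsCompression.comp {ψ : B.Elem →L[ℂ] C.Elem} {φ : A.Elem →L[ℂ] B.Elem}
    (hψ : IsCompression ψ) (hφ : IsCompression φ) : IsCompression (ψ.comp φ) := by
  obtain ⟨b, hb⟩ := hφ
  obtain ⟨c, hc⟩ := hψ
  have hψb : ψ b ≤ c := hc.map_one ▸ hc.isContractiveNCP.monotone hb.le_one
  refine ⟨ψ b, ⟨hc.isContractiveNCP.comp hb.isContractiveNCP,
    hc.isContractiveNCP.map_nonneg hb.nonneg, hψb.trans hc.le_one, ?_, fun D g hg hg1 => ?_⟩⟩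
  · rw [ContinuousLinearMap.comp_apply, hb.map_one]
  · obtain ⟨k, ⟨hk, hψk⟩, hkuniq⟩ := hc.universal D g hg (hg1.trans hψb)
    have hk1 : k 1 ≤ b := hc.le_of_map_le (hk.map_nonneg zero_le_one) hb.nonneg hb.le_one (by
      rw [← hψk] at hg1
      exact hg1)
    obtain ⟨l, ⟨hl, hφl⟩, hluniq⟩ := hb.universal D k hk hk1
    refine ⟨l, ⟨hl, ?_⟩, fun l' hl' => hluniq l' ⟨hl'.1, ?_⟩⟩
    · rw [ContinuousLinearMap.comp_assoc, hφl, hψk]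
    · exact hkuniq _ ⟨hb.isContractiveNCP.comp hl'.1, by
        rw [← ContinuousLinearMap.comp_assoc, hl'.2]⟩

end Compression

/-! ### Isomorphisms between hereditary subalgebras -/

section PartialIso

variable {L : Type u} [NormedAddCommGroup L] [InnerProductSpace ℂ L] [CompleteSpace L]
  {A : VonNeumannAlgebra H} {B : VonNeumannAlgebra K} {C : VonNeumannAlgebra L}

/-- NCP-maps `α` and `β` that restrict to mutually inverse unital maps between `pAp` and `eBe`, and
factor through these subalgebras. -/
structure IsPartialIso (α : A.Elem →L[ℂ] B.Elem) (β : B.Elem →L[ℂ] A.Elem) (p : A.Elem)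
    (e : B.Elem) : Prop where
  isNCP_left : IsNCP α
  isNCP_right : IsNCP β
  proj_left : IsStarProjection p
  proj_right : IsStarProjection e
  left_inv : ∀ x, β (α x) = p * x * p
  right_inv : ∀ y, α (β y) = e * y * e
  map_left : ∀ x, e * α x * e = α x
  map_right : ∀ y, p * β y * p = β y
  one_left : α 1 = e
  one_right : β 1 = p

namespace IsPartialIso

variable {α : A.Elem →L[ℂ] B.Elem} {α' : B.Elem →L[ℂ] A.Elem} {p : A.Elem} {e : B.Elem}

theorem symm (h : IsPartialIso α α' p e) : IsPartialIso α' α e p :=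
  ⟨h.isNCP_right, h.isNCP_left, h.proj_right, h.proj_left, h.right_inv, h.left_inv, h.map_right,
    h.map_left, h.one_right, h.one_left⟩

theorem map_compress (h : IsPartialIso α α' p e) (x : A.Elem) : α (p * x * p) = α x := by
  rw [← h.left_inv, h.right_inv, h.map_left]

theorem mul_map (h : IsPartialIso α α' p e) (x : A.Elem) : e * α x = α x := by
  rw [← h.map_left x, mul_assoc e, ← mul_assoc e e, h.proj_right.isIdempotentElem.eq]

theorem map_mul_right (h : IsPartialIso α α' p e) (x : A.Elem) : α x * e = α x := by
  rw [← h.map_left x, mul_assoc _ e e, h.proj_right.isIdempotentElem.eq]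

/-- Kadison-Schwarz in both directions: after replacing `x` by `y = pxp`, the defect `α(y⋆y) -
α(y)⋆α(y)` is positive, and the inequality for `α'` shows that `α'` kills it. Since the defect lies
in `eBe`, where `α ∘ α'` is the identity, it is zero. -/
theorem map_star_mul_self (h : IsPartialIso α α' p e) (x : A.Elem) :
    α (star x * p * x) = star (α x) * α x := by
  have hps := h.proj_left.isSelfAdjoint.star_eq
  have hpp := h.proj_left.isIdempotentElem.eq
  obtain ⟨y, hy⟩ : ∃ y, y = p * x * p := ⟨_, rfl⟩
  have hyp : p * (star y * y) * p = star y * y := by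
    rw [hy, star_mul, star_mul, hps]
    simp only [mul_assoc, hpp]
    simp only [← mul_assoc, hpp]
  have hxy : α (star x * p * x) = α (star y * y) := by
    rw [← h.map_compress (star x * p * x), hy, star_mul, star_mul, hps]
    congr 1
    simp only [mul_assoc]
    rw [← mul_assoc p p (x * p), hpp]
  rw [hxy, ← h.map_compress x, ← hy]
  have hα1 : α 1 ≤ 1 := h.one_left ▸ h.proj_right.le_one
  have hα1' : α' 1 ≤ 1 := h.one_right ▸ h.proj_left.le_one
  have hd : 0 ≤ α (star y * y) - star (α y) * α y :=
    sub_nonneg.mpr (h.isNCP_left.star_map_mul_map_le hα1 y)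
  have h1 : α' (α (star y * y) - star (α y) * α y) = 0 := by
    refine le_antisymm ?_ (h.isNCP_right.map_nonneg hd)
    rw [map_sub, sub_nonpos, h.left_inv, hyp]
    have h2 := h.isNCP_right.star_map_mul_map_le hα1' (α y)
    have h3 : p * y * p = y := by
      rw [hy]
      simp only [mul_assoc, hpp]
      simp only [← mul_assoc, hpp]
    rwa [h.left_inv, h3] at h2
  have h2 := h.right_inv (α (star y * y) - star (α y) * α y)
  rw [h1, map_zero] at h2
  rw [mul_sub, sub_mul, h.map_left, ← mul_assoc e, ← h.isNCP_left.map_star, h.mul_map, mul_assoc,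
    h.map_mul_right, eq_comm, sub_eq_zero] at h2
  rw [h2, h.isNCP_left.map_star]

theorem map_star_mul (h : IsPartialIso α α' p e) (x y : A.Elem) :
    α (star x * p * y) = star (α x) * α y := by
  have h1 := h.map_star_mul_self (x + y)
  -- Polarisation: `x + y` gives the sum of the two cross terms and `x + iy` their difference.
  have h2 := h.map_star_mul_self (x + Complex.I • y)
  simp only [map_add, star_add, add_mul, mul_add, h.map_star_mul_self x, h.map_star_mul_self y]
    at h1
  simp only [map_add, star_add, add_mul, mul_add, map_smul, star_smul, smul_mul_assoc,
    mul_smul_comm, h.map_star_mul_self x, h.map_star_mul_self y, Complex.star_def,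
    Complex.conj_I] at h2
  have h3 : α (star x * p * y) + α (star y * p * x) = star (α x) * α y + star (α y) * α x := by
    rw [← sub_eq_zero] at h1 ⊢
    rw [← h1]
    abel
  have h4 : Complex.I • (α (star x * p * y) - α (star y * p * x)) =
      Complex.I • (star (α x) * α y - star (α y) * α x) := by
    rw [← sub_eq_zero] at h2 ⊢
    rw [← h2]
    module
  have h5 := smul_right_injective _ Complex.I_ne_zero h4
  have h6 : (2 : ℂ) • α (star x * p * y) = (2 : ℂ) • (star (α x) * α y) := by
    have h7 := congrArg₂ (· + ·) h3 h5
    rw [← sub_eq_zero] at h7 ⊢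
    rw [← h7]
    module
  exact smul_right_injective _ two_ne_zero h6

theorem map_mul (h : IsPartialIso α α' p e) (x y : A.Elem) : α (x * p * y) = α x * α y := by
  have := h.map_star_mul (star x) y
  rwa [star_star, h.isNCP_left.map_star, star_star] at this

theorem of_conj {u m : A.Elem} (hm : IsStarProjection m) (hu : star u * u = m) (hum : u * m = u) :
    IsPartialIso (conj u) (conj (star u)) (u * star u) m where
  isNCP_left := isNCP_conj _
  isNCP_right := isNCP_conj _
  proj_left := ⟨by rw [IsIdempotentElem, ← mul_assoc, mul_assoc u, hu, hum],
    by rw [IsSelfAdjoint, star_mul, star_star]⟩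
  proj_right := hm
  left_inv x := by simp only [conj_apply, star_star, mul_assoc]
  right_inv y := by simp only [conj_apply, star_star, mul_assoc, ← hu]
  map_left x := by
    have hum' : m * star u = star u := by
      have := congrArg star hum
      rwa [star_mul, hm.isSelfAdjoint.star_eq] at this
    simp only [conj_apply, mul_assoc, hum]
    simp only [← mul_assoc, hum']
  map_right y := by
    have h1 : star u * (u * star u) = star u := by
      have := congrArg star hum
      rwa [← hu, star_mul, star_mul, star_star, mul_assoc] at this
    have h2 : u * star u * u = u := by rw [mul_assoc, hu, hum]
    simp only [conj_apply, star_star]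
    rw [mul_assoc (u * star u), mul_assoc (u * y), h1, ← mul_assoc, ← mul_assoc, h2]
  one_left := by rw [conj_apply, mul_one, hu]
  one_right := by rw [conj_apply, mul_one, star_star]

/-- The hypothesis `he` says `e' ≤ e`, so the composite is defined on the part of `pAp` that `α`
carries onto `e'Be'`; its unit `α' e'` is a projection by multiplicativity of `α'`. -/
theorem comp {β : B.Elem →L[ℂ] C.Elem} {β' : C.Elem →L[ℂ] B.Elem} {e' : B.Elem} {k : C.Elem}
    (hα : IsPartialIso α α' p e) (hβ : IsPartialIso β β' e' k) (he : e * e' = e') :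
    IsPartialIso (β.comp α) (α'.comp β') (α' e') k := by
  have he' : e' * e = e' := by
    have := congrArg star he
    rwa [star_mul, hα.proj_right.isSelfAdjoint.star_eq, hβ.proj_left.isSelfAdjoint.star_eq]
      at this
  have hee := hβ.proj_left.isIdempotentElem.eq
  have key : ∀ y, α' e' * α' y * α' e' = α' (e' * y * e') := fun y => by
    rw [← hα.symm.map_mul, ← hα.symm.map_mul, he', mul_assoc, he]
  refine ⟨hβ.isNCP_left.comp hα.isNCP_left, hα.isNCP_right.comp hβ.isNCP_right,
    ⟨?_, hα.isNCP_right.isSelfAdjoint hβ.proj_left.isSelfAdjoint⟩, hβ.proj_right, fun x => ?_,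
    fun y => ?_, fun x => hβ.map_left _, fun y => ?_, ?_, ?_⟩
  · rw [IsIdempotentElem, ← hα.symm.map_mul, he', hee]
  · simp only [ContinuousLinearMap.comp_apply, hβ.left_inv]
    rw [← key, hα.left_inv]
    simp only [mul_assoc, hα.symm.mul_map]
    simp only [← mul_assoc, hα.symm.map_mul_right]
  · simp only [ContinuousLinearMap.comp_apply, hα.right_inv]
    rw [← hβ.symm.mul_map, ← mul_assoc, he, mul_assoc, mul_assoc, ← hβ.symm.map_mul_right,
      mul_assoc, he', ← mul_assoc, hβ.map_compress, hβ.right_inv, mul_assoc]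
  · rw [ContinuousLinearMap.comp_apply, key, hβ.map_right]
  · rw [ContinuousLinearMap.comp_apply, hα.one_left, ← hβ.map_compress, he', hee, ← hβ.one_left,
      ← hβ.map_compress 1, mul_one, hee]
  · rw [ContinuousLinearMap.comp_apply, hβ.one_right]

theorem comp_of_le {β : B.Elem →L[ℂ] C.Elem} {β' : C.Elem →L[ℂ] B.Elem} {e' : B.Elem} {k : C.Elem}
    (hα : IsPartialIso α α' p e) (hβ : IsPartialIso β β' e' k) (he : e' * e = e) :
    IsPartialIso (β.comp α) (α'.comp β') p (β e) :=
  (hβ.symm.comp hα.symm he).symm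

end IsPartialIso

end PartialIso

/-! ### Pure maps -/

section Pure

variable {L : Type u} [NormedAddCommGroup L] [InnerProductSpace ℂ L] [CompleteSpace L]
  {A : VonNeumannAlgebra H} {B : VonNeumannAlgebra K} {C : VonNeumannAlgebra L}

/-- A map has *pure form* if it is a partial isomorphism followed by a conjugation. -/
def HasPureForm (φ : A.Elem →L[ℂ] B.Elem) : Prop :=
  ∃ (α : A.Elem →L[ℂ] B.Elem) (α' : B.Elem →L[ℂ] A.Elem) (p : A.Elem) (e t : B.Elem),
    IsPartialIso α α' p e ∧ ∀ x, φ x = star t * α x * t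

theorem HasPureForm.isNCP {φ : A.Elem →L[ℂ] B.Elem} (hφ : HasPureForm φ) : IsNCP φ := by
  obtain ⟨α, α', p, e, t, hα, h⟩ := hφ
  rw [show φ = (conj t).comp α from ContinuousLinearMap.ext h]
  exact (isNCP_conj t).comp hα.isNCP_left

theorem HasPureForm.smul {φ : A.Elem →L[ℂ] B.Elem} (hφ : HasPureForm φ) {r : ℝ} (hr : 0 ≤ r) :
    HasPureForm ((r : ℂ) • φ) := by
  obtain ⟨α, α', p, e, t, hα, h⟩ := hφ
  refine ⟨α, α', p, e, ((√r : ℝ) : ℂ) • t, hα, fun x => ?_⟩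
  rw [smul_apply, h, star_smul, smul_mul_assoc, smul_mul_assoc, mul_smul_comm,
    smul_smul, Complex.star_def, Complex.conj_ofReal, ← Complex.ofReal_mul, Real.mul_self_sqrt hr]

/-- Conjugation of a partial isomorphism `α` by the partial isometry of the polar decomposition of
an element `r` with `e r = r`. -/
theorem IsPartialIso.exists_conj_eq {α : A.Elem →L[ℂ] B.Elem} {α' : B.Elem →L[ℂ] A.Elem}
    {p : A.Elem} {e : B.Elem} (hα : IsPartialIso α α' p e) {r : B.Elem} (hr : e * r = r) :
    ∃ (γ : A.Elem →L[ℂ] B.Elem) (γ' : B.Elem →L[ℂ] A.Elem) (p' : A.Elem) (m : B.Elem),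
      IsPartialIso γ γ' p' m ∧
      (∀ x, star r * α x * r = CFC.sqrt (star r * r) * γ x * CFC.sqrt (star r * r)) ∧
      m * CFC.sqrt (star r * r) = CFC.sqrt (star r * r) ∧
      ∀ w, m.op w ∈ closure (Set.range (CFC.sqrt (star r * r)).op) := by
  obtain ⟨u, hua, hm, hum, hma, hcl⟩ := exists_polar r
  have ha0 : 0 ≤ CFC.sqrt (star r * r) := CFC.sqrt_nonneg _
  -- The range of `u` lies in that of `e`, so `u u⋆ ≤ e`, which is what composing `α` with
  -- conjugation by `u` requires.
  have heu : e * u = u := by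
    have h1 : (1 - e) * u * CFC.sqrt (star r * r) = 0 := by
      rw [mul_assoc, hua, sub_mul, one_mul, hr, sub_self]
    have h2 := Elem.mul_eq_zero_of_range_subset_closure hcl h1
    rw [mul_assoc, hum, sub_mul, one_mul, sub_eq_zero] at h2
    exact h2.symm
  refine ⟨_, _, _, _, hα.comp (IsPartialIso.of_conj hm rfl hum) (by rw [← mul_assoc, heu]),
    fun x => ?_, hma, hcl⟩
  rw [ContinuousLinearMap.comp_apply, conj_apply]
  generalize CFC.sqrt (star r * r) = a at hua ha0 ⊢
  rw [← hua, star_mul, ha0.star_eq]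
  simp only [mul_assoc]

theorem sqrt_mul_projection {r q : B.Elem} (hq : IsStarProjection q) (h : r * q = r) :
    q * CFC.sqrt (star r * r) = CFC.sqrt (star r * r) := by
  set a := CFC.sqrt (star r * r) with ha
  have ha0 : 0 ≤ a := CFC.sqrt_nonneg _
  have haa : a * a = star r * r := CFC.sqrt_mul_sqrt_self _ (star_mul_self_nonneg r)
  have h1 : a * (1 - q) = 0 := by
    refine eq_zero_of_star_mul_self_eq_zero ?_
    rw [star_mul, ha0.star_eq, mul_assoc, ← mul_assoc a, haa, mul_assoc, mul_sub r, mul_one, h,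
      sub_self, mul_zero, mul_zero]
  have h2 := congrArg star h1
  rw [star_mul, ha0.star_eq, hq.one_sub.isSelfAdjoint.star_eq, star_zero, sub_mul, one_mul,
    sub_eq_zero] at h2
  exact h2.symm

theorem HasPureForm.comp {ψ : B.Elem →L[ℂ] C.Elem} {φ : A.Elem →L[ℂ] B.Elem}
    (hψ : HasPureForm ψ) (hφ : HasPureForm φ) : HasPureForm (ψ.comp φ) := by
  obtain ⟨α, α', p, e, t, hα, hφα⟩ := hφ
  obtain ⟨β, β', q, k, s, hβ, hψβ⟩ := hψ
  -- `α` takes values in `eBe` and `β` only sees `qBq`, so `t` may be cut down to `e t q`. Because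
  -- `r q = r`, the range projection `m` of `a` lies below `q`, and `β` can follow `γ` without loss.
  set r := e * t * q with hr
  have her : e * r = r := by
    rw [hr, ← mul_assoc, ← mul_assoc, hα.proj_right.isIdempotentElem.eq]
  have hrq : r * q = r := by rw [hr, mul_assoc, hβ.proj_left.isIdempotentElem.eq]
  obtain ⟨γ, γ', p', m, hγ, hγa, hma, hcl⟩ := hα.exists_conj_eq her
  have hqa := sqrt_mul_projection hβ.proj_left hrq
  have ha0 : 0 ≤ CFC.sqrt (star r * r) := CFC.sqrt_nonneg _
  set a := CFC.sqrt (star r * r) with ha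
  have haq : a * q = a := by
    have := congrArg star hqa
    rwa [star_mul, ha0.star_eq, hβ.proj_left.isSelfAdjoint.star_eq] at this
  have hqm : q * m = m := by
    have h1 : (1 - q) * a = 0 := by rw [sub_mul, one_mul, hqa, sub_self]
    have h2 := Elem.mul_eq_zero_of_range_subset_closure hcl h1
    rw [sub_mul, one_mul, sub_eq_zero] at h2
    exact h2.symm
  refine ⟨_, _, _, _, β a * s, hγ.comp_of_le hβ hqm, fun x => ?_⟩
  have h1 : q * (star t * α x * t) * q = a * q * (γ x * q * a) := by
    rw [haq, mul_assoc (γ x), hqa, ← mul_assoc a, ← hγa, hr, star_mul, star_mul,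
      hα.proj_right.isSelfAdjoint.star_eq, hβ.proj_left.isSelfAdjoint.star_eq]
    conv_lhs => rw [← hα.map_left x]
    simp only [mul_assoc]
  rw [ContinuousLinearMap.comp_apply, ContinuousLinearMap.comp_apply, hψβ, hφα,
    ← hβ.map_compress, h1, hβ.map_mul, hβ.map_mul, star_mul,
    (hβ.isNCP_left.isSelfAdjoint (.of_nonneg ha0)).star_eq]
  simp only [mul_assoc]

theorem mul_sqrt_eq_zero {b z : B.Elem} (hb : 0 ≤ b) (h : z * b = 0) : z * CFC.sqrt b = 0 := by
  rw [← star_eq_zero]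
  refine eq_zero_of_star_mul_self_eq_zero ?_
  rw [star_star, star_mul, (CFC.sqrt_nonneg b).star_eq, mul_assoc, ← mul_assoc (CFC.sqrt b),
    CFC.sqrt_mul_sqrt_self b hb, ← mul_assoc, h, zero_mul]

/-- Polar decomposition of `e t` rewrites `φ x` as `a γ(x) a` with `a = √φ(1)`, and the target
projection of `γ` lies in the closed range of `a`. Then `γ` itself, read between the corner
algebras, is the middle part and `γ'` its inverse. -/
theorem HasPureForm.exists_middle {φ : A.Elem →L[ℂ] B.Elem} (hφ : HasPureForm φ) (h1 : φ 1 ≤ 1) :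
    ∃ (p : A.Elem) (q : B.Elem) (hp : IsStarProjection p) (hq : IsStarProjection q)
      (ψ : (A.cornerAlgebra p hp).Elem →L[ℂ] (B.cornerAlgebra q hq).Elem),
      IsMiddlePart φ hp hq ψ ∧ IsNCPIso ψ := by
  have hncp := hφ.isNCP
  obtain ⟨α, α', p₀, e, t, hα, hφα⟩ := hφ
  have her : e * (e * t) = e * t := by rw [← mul_assoc, hα.proj_right.isIdempotentElem.eq]
  obtain ⟨γ, γ', p, q, hγ, hγa, hqa, hcl⟩ := hα.exists_conj_eq her
  have hφr : ∀ x, φ x = star (e * t) * α x * (e * t) := fun x => by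
    rw [hφα, star_mul, hα.proj_right.isSelfAdjoint.star_eq]
    conv_lhs => rw [← hα.map_left x]
    simp only [mul_assoc]
  have hφ1 : φ 1 = star (e * t) * (e * t) := by rw [hφr, hα.one_left, mul_assoc, her]
  rw [← hφ1] at hγa hqa hcl
  have hφ0 : 0 ≤ φ 1 := hncp.map_nonneg zero_le_one
  have ha0 : 0 ≤ CFC.sqrt (φ 1) := CFC.sqrt_nonneg _
  have haa : CFC.sqrt (φ 1) * CFC.sqrt (φ 1) = φ 1 := CFC.sqrt_mul_sqrt_self _ hφ0
  set a := CFC.sqrt (φ 1) with ha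
  have hφγ : ∀ x, φ x = a * γ x * a := fun x => by rw [hφr, hγa]
  have hp := hγ.proj_left
  have hq := hγ.proj_right
  have hqbq : q * φ 1 * q = φ 1 := by
    have h2 := congrArg star hqa
    rw [star_mul, ha0.star_eq, hq.isSelfAdjoint.star_eq] at h2
    rw [← haa, ← mul_assoc q, hqa, mul_assoc, h2]
  refine ⟨p, q, hp, hq, (standardCorner q hq).comp (γ.comp (cornerInclusion p hp)),
    ⟨⟨⟨hp, ?_⟩, fun r hr => ?_⟩, ⟨⟨hq, ?_⟩, fun r hr => ?_⟩, ?_, ?_⟩, ?_,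
    (standardCorner p hp).comp (γ'.comp (cornerInclusion q hq)), ?_, fun x => ?_, fun y => ?_⟩
  · rw [hφγ, hφγ 1, ← hγ.map_compress 1, mul_one, hp.isIdempotentElem.eq]
  -- Minimality of the carrier: `a γ(1 - r) a = 0` forces `γ(1 - r) = 0`, as multiplication by `a`
  -- can be cancelled on `qBq`; applying `γ'` gives `p(1 - r)p = 0`, so `p ≤ r`.
  · obtain ⟨hr, hφr⟩ := hr
    have h2 : a * γ (1 - r) * a = 0 := by rw [← hφγ, map_sub, hφr, sub_self]
    obtain ⟨s, hs⟩ := exists_eq_star_mul_self_of_nonneg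
      (hγ.isNCP_left.map_nonneg hr.one_sub_nonneg)
    have h3 : s * a = 0 := by
      refine eq_zero_of_star_mul_self_eq_zero ?_
      rw [star_mul, ha0.star_eq, ← h2, hs]
      simp only [mul_assoc]
    have h4 : s * q = 0 := Elem.mul_eq_zero_of_range_subset_closure hcl h3
    have h5 : γ (1 - r) = 0 := by rw [← hγ.map_mul_right, hs, mul_assoc, h4, mul_zero]
    have h6 : p * (1 - r) * p = 0 := by rw [← hγ.left_inv, h5, map_zero]
    have h7 : (1 - r) * p = 0 := by
      refine eq_zero_of_star_mul_self_eq_zero ?_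
      rw [star_mul, hp.isSelfAdjoint.star_eq, hr.one_sub.isSelfAdjoint.star_eq, mul_assoc,
        ← mul_assoc (1 - r), hr.one_sub.isIdempotentElem.eq, ← mul_assoc, h6]
    rw [sub_mul, one_mul, sub_eq_zero] at h7
    exact (hp.le_iff_mul_eq_right hr).mpr h7.symm
  · rw [← hqbq]
    refine (hq.isSelfAdjoint.conjugate_le_conjugate h1).trans_eq ?_
    rw [mul_one, hq.isIdempotentElem.eq]
  · obtain ⟨hr, hbr⟩ := hr
    have h2 := (hr.mul_right_and_mul_left_of_nonneg_of_le hφ0 hbr).2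
    have h3 : (1 - r) * a = 0 := mul_sqrt_eq_zero hφ0 (by rw [sub_mul, one_mul, h2, sub_self])
    have h4 := Elem.mul_eq_zero_of_range_subset_closure hcl h3
    rw [sub_mul, one_mul, sub_eq_zero] at h4
    exact (hq.le_iff_mul_eq_right hr).mpr h4.symm
  · exact (isContractiveNCP_standardCorner q hq).toIsNCP.comp
      (hγ.isNCP_left.comp (isContractiveNCP_cornerInclusion p hp).toIsNCP)
  · refine ContinuousLinearMap.ext fun x => ?_
    change a * cornerInclusion q hq (standardCorner q hq
      (γ (cornerInclusion p hp (standardCorner p hp x)))) * a = φ x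
    rw [cornerInclusion_standardCorner, cornerInclusion_standardCorner, hγ.map_compress,
      hγ.map_left, hφγ]
  · exact (isContractiveNCP_standardCorner q hq).toIsNCP.comp
      (hγ.isNCP_left.comp (isContractiveNCP_cornerInclusion p hp).toIsNCP)
  · exact (isContractiveNCP_standardCorner p hp).toIsNCP.comp
      (hγ.isNCP_right.comp (isContractiveNCP_cornerInclusion q hq).toIsNCP)
  · simp only [ContinuousLinearMap.comp_apply]
    rw [cornerInclusion_standardCorner, hγ.map_left, hγ.left_inv, mul_cornerInclusion_mul,
      standardCorner_cornerInclusion]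
  · simp only [ContinuousLinearMap.comp_apply]
    rw [cornerInclusion_standardCorner, hγ.map_right, hγ.right_inv, mul_cornerInclusion_mul,
      standardCorner_cornerInclusion]

theorem norm_normalize_le (φ : A.Elem →L[ℂ] B.Elem) : ‖normalize φ‖ ≤ 1 := by
  have h : 0 < max 1 ‖φ‖ := lt_max_of_lt_left one_pos
  rw [normalize, norm_smul, Complex.norm_real, Real.norm_of_nonneg (by positivity),
    inv_mul_le_iff₀ h, mul_one]
  exact le_max_right _ _

theorem HasPureForm.isPure {φ : A.Elem →L[ℂ] B.Elem} (hφ : HasPureForm φ) : IsPure φ := by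
  have h : HasPureForm (normalize φ) := hφ.smul (by positivity)
  exact ⟨hφ.isNCP, h.exists_middle (IsContractiveNCP.map_one_le ⟨h.isNCP, norm_normalize_le φ⟩)⟩

/-- The middle part of a contractive map is unital. -/
theorem IsMiddlePart.cornerInclusion_map_one {φ : A.Elem →L[ℂ] B.Elem} (hφ1 : φ 1 ≤ 1)
    {p : A.Elem} {q : B.Elem} {hp : IsStarProjection p} {hq : IsStarProjection q}
    {ψ : (A.cornerAlgebra p hp).Elem →L[ℂ] (B.cornerAlgebra q hq).Elem}
    (h : IsMiddlePart φ hp hq ψ) : cornerInclusion q hq (ψ 1) = q := by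
  have hφψ : ∀ x, CFC.sqrt (φ 1) * cornerInclusion q hq (ψ (standardCorner p hp x)) *
      CFC.sqrt (φ 1) = φ x := fun x => congrArg (fun T : A.Elem →L[ℂ] B.Elem => T x) h.factor
  have hψ0 : 0 ≤ ψ 1 := h.isNCP.map_nonneg zero_le_one
  have hy0 := (isContractiveNCP_cornerInclusion q hq).map_nonneg hψ0
  have hqy := mul_cornerInclusion_mul q hq (ψ 1)
  have hφy := hφψ 1
  rw [standardCorner_one] at hφy
  set y := cornerInclusion q hq (ψ 1) with hy
  have hφ0 : 0 ≤ φ 1 := by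
    rw [← hφy]
    exact (CFC.sqrt_nonneg (φ 1)).isSelfAdjoint.conjugate_nonneg hy0
  have ha0 : 0 ≤ CFC.sqrt (φ 1) := CFC.sqrt_nonneg _
  have haa : CFC.sqrt (φ 1) * CFC.sqrt (φ 1) = φ 1 := CFC.sqrt_mul_sqrt_self _ hφ0
  set a := CFC.sqrt (φ 1) with ha
  obtain ⟨m, hm, hma, hcl⟩ := exists_range_projection ha0
  have ham : a * m = a := by
    have := congrArg star hma
    rwa [star_mul, ha0.star_eq, hm.isSelfAdjoint.star_eq] at this
  -- The range projection `m` of `a` dominates `φ(1) = m φ(1) m ≤ m`, so minimality of `q` applies.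
  -- Hence `q - y` lives under `m`, and `a` can be cancelled on each side of `a (q - y) a = φ(1) -
  -- φ(1) = 0`.
  have hqm : q ≤ m := h.isSupport.2 ⟨hm, by
    have h2 : m * φ 1 * m = φ 1 := by rw [← haa, ← mul_assoc, hma, mul_assoc, ham]
    rw [← h2]
    refine (hm.isSelfAdjoint.conjugate_le_conjugate hφ1).trans_eq ?_
    rw [mul_one, hm.isIdempotentElem.eq]⟩
  have hqm' : q * m = q := (hq.le_iff_mul_eq_left hm).mp hqm
  have hqa : q * a = a := by
    have h2 := (hq.mul_right_and_mul_left_of_nonneg_of_le hφ0 h.isSupport.1.2).2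
    have h3 : (1 - q) * a = 0 := mul_sqrt_eq_zero hφ0 (by rw [sub_mul, one_mul, h2, sub_self])
    rw [sub_mul, one_mul, sub_eq_zero] at h3
    exact h3.symm
  have hd : (q - y) * q = q - y := by
    rw [← hqy, sub_mul, mul_assoc _ q q, hq.isIdempotentElem.eq]
  have hdm : (q - y) * m = q - y := by rw [← hd, mul_assoc, hqm']
  have h1 : a * (q - y) * a = 0 := by rw [mul_sub, sub_mul, mul_assoc a q, hqa, haa, hφy, sub_self]
  have h2 := Elem.mul_eq_zero_of_range_subset_closure hcl h1
  rw [mul_assoc, hdm] at h2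
  have h3 := congrArg star h2
  rw [star_mul, star_sub, hq.isSelfAdjoint.star_eq, hy0.star_eq, ha0.star_eq, star_zero] at h3
  have h4 := Elem.mul_eq_zero_of_range_subset_closure hcl h3
  rw [hdm, sub_eq_zero] at h4
  exact h4.symm

/-- Pre- and postcomposing the middle part and its inverse with standard corners and inclusions
gives a partial isomorphism, with `t = √φ(1)` after normalisation. Unitality of the middle part
supplies the conditions on the images of `1`. -/
theorem IsPure.hasPureForm {φ : A.Elem →L[ℂ] B.Elem} (hφ : IsPure φ) : HasPureForm φ := by
  obtain ⟨hncp, p, q, hp, hq, ψ, hmid, hψ, ψ', hψ', hl, hr⟩ := hφ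
  have hpos : 0 < max 1 ‖φ‖ := lt_max_of_lt_left one_pos
  have hφn : φ = ((max 1 ‖φ‖ : ℝ) : ℂ) • normalize φ := by
    rw [normalize, smul_smul, ← Complex.ofReal_mul, mul_inv_cancel₀ hpos.ne', Complex.ofReal_one,
      one_smul]
  rw [hφn]
  refine HasPureForm.smul ?_ hpos.le
  have hn0 : 0 ≤ normalize φ 1 := by
    rw [normalize, smul_apply, Complex.coe_smul]
    exact smul_nonneg (by positivity) (hncp.map_nonneg zero_le_one)
  have hn1 : normalize φ 1 ≤ 1 := by
    rw [← CStarAlgebra.norm_le_one_iff_of_nonneg _ hn0]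
    refine ((normalize φ).le_of_opNorm_le (norm_normalize_le φ) 1).trans ?_
    rw [one_mul]
    exact (CStarAlgebra.norm_le_one_iff_of_nonneg (1 : A.Elem) zero_le_one).mpr le_rfl
  have hα1 := hmid.cornerInclusion_map_one hn1
  have hψ1 : ψ 1 = 1 := by
    have h1 := congrArg (standardCorner q hq) (hα1.trans (cornerInclusion_one q hq).symm)
    rwa [standardCorner_cornerInclusion, standardCorner_cornerInclusion] at h1
  have hψ'1 : ψ' 1 = 1 := by rw [← hψ1, hl]
  refine ⟨(cornerInclusion q hq).comp (ψ.comp (standardCorner p hp)),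
    (cornerInclusion p hp).comp (ψ'.comp (standardCorner q hq)), p, q,
    CFC.sqrt (normalize φ 1), ⟨?_, ?_, hp, hq, fun x => ?_, fun y => ?_,
    fun x => mul_cornerInclusion_mul _ _ _, fun y => mul_cornerInclusion_mul _ _ _, ?_, ?_⟩,
    fun x => ?_⟩
  · exact (isContractiveNCP_cornerInclusion q hq).toIsNCP.comp
      (hψ.comp (isContractiveNCP_standardCorner p hp).toIsNCP)
  · exact (isContractiveNCP_cornerInclusion p hp).toIsNCP.comp
      (hψ'.comp (isContractiveNCP_standardCorner q hq).toIsNCP)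
  · simp only [ContinuousLinearMap.comp_apply]
    rw [standardCorner_cornerInclusion, hl, cornerInclusion_standardCorner]
  · simp only [ContinuousLinearMap.comp_apply]
    rw [standardCorner_cornerInclusion, hr, cornerInclusion_standardCorner]
  · rw [ContinuousLinearMap.comp_apply, ContinuousLinearMap.comp_apply, standardCorner_one, hα1]
  · rw [ContinuousLinearMap.comp_apply, ContinuousLinearMap.comp_apply, standardCorner_one, hψ'1,
      cornerInclusion_one]
  · rw [(CFC.sqrt_nonneg (normalize φ 1)).star_eq]
    exact (congrArg (fun T : A.Elem →L[ℂ] B.Elem => T x) hmid.factor).symm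

theorem IsPure.comp {ψ : B.Elem →L[ℂ] C.Elem} {φ : A.Elem →L[ℂ] B.Elem}
    (hψ : IsPure ψ) (hφ : IsPure φ) : IsPure (ψ.comp φ) :=
  (hψ.hasPureForm.comp hφ.hasPureForm).isPure

end Pure

end VonNeumannAlgebra

theorem mainTheorem10 {H K L : Type u}
    [NormedAddCommGroup H] [InnerProductSpace ℂ H] [CompleteSpace H]
    [NormedAddCommGroup K] [InnerProductSpace ℂ K] [CompleteSpace K]
    [NormedAddCommGroup L] [InnerProductSpace ℂ L] [CompleteSpace L]
    (A : VonNeumannAlgebra H) (B : VonNeumannAlgebra K) (C : VonNeumannAlgebra L)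
    (φ : A.Elem →L[ℂ] B.Elem) (ψ : B.Elem →L[ℂ] C.Elem) :
    (VonNeumannAlgebra.IsCorner φ → VonNeumannAlgebra.IsCorner ψ →
      VonNeumannAlgebra.IsCorner (ψ.comp φ)) ∧
    (VonNeumannAlgebra.IsCompression φ → VonNeumannAlgebra.IsCompression ψ →
      VonNeumannAlgebra.IsCompression (ψ.comp φ)) ∧
    (VonNeumannAlgebra.IsPure φ → VonNeumannAlgebra.IsPure ψ →
      VonNeumannAlgebra.IsPure (ψ.comp φ)) :=
  ⟨fun hφ hψ => hψ.comp hφ, fun hφ hψ => hψ.comp hφ, fun hφ hψ => hψ.comp hφ⟩
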